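/- Let $w$ be a word of length $n$ over an arbitrary alphabet. For a word $u$ let $\mathrm{Occ}(u,w)$ be the set of starting positions of occurrences of $u$ in $w$, let $\mathrm{Covered}(u,w)$ be the number of positions of $w$ lying within at least one occurrence of $u$ in $w$, and let $\Delta(u)$ be the number of $i\in\mathrm{Occ}(u,w)$ such that the next larger element of $\mathrm{Occ}(u,w)$ is at least $i+|u|$ or does not exist. A shortest $\alpha$-partial cover of $w$ is a factor $u$ of $w$ of minimum length among all factors with $\mathrm{Covered}(u,w)\ge\alpha$. The Cover Suffix Tree $\mathit{CST}(w)$ is the compact tree whose explicit nodes are the following factors $u$ of $w$: the suffixes of $w$ (including $w$ and the empty word, which is the root), the factors $u$ such that $ua$ and $ub$ are factors of $w$ for two distinct letters $a\neq b$, and the primitive words $u$ such that $uu$ is a factor of $w$. The parent of a non-root explicit node is its longest proper prefix that is an explicit node. The nodes are numbered $0,\dots,m-1$ in an arbitrary order, and $\mathit{CST}(w)$ is given by $n$, $m$ and, for every explicit node $v$, the number of its parent, its length $|v|$, the starting position of some occurrence of $v$ in $w$, and the annotations $c(v)=\mathrm{Covered}(v,w)$ and $\Delta(v)$. The locus of a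 factor $u$ of $w$ is the pair $(v,j)$ of an explicit node $v$ and an integer $j\ge 0$ such that $u$ is the prefix of $v$ of length $|v|-j$ and either $j=0$ or $|v|-j>|v'|$, where $v'$ is the parent of $v$. **Lemma.** There is a single algorithm (a fixed program for the word RAM with unit-cost arithmetic on words of $O(\log n)$ bits) that, for every word $w$, given $\mathit{CST}(w)$, computes for every $\alpha=1,2,\dots,n$ the locus of a shortest $\alpha$-partial cover of $w$, in $O(n\log n)$ time and $O(n)$ space (the space including the given $\mathit{CST}(w)$). The implied constants are absolute. -/

import Mathlib

namespace PartialCovers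

/-! ### Words, occurrences, cover index -/

section Words

variable {A : Type*}

open Classical in
/-- `Occ(u, w)`: the set of starting positions (counted from `0`) of occurrences of `u` in `w`. -/
noncomputable def occ (u w : List A) : Finset ℕ :=
  (Finset.range (w.length + 1)).filter fun i => u <+: w.drop i

open Classical in
/-- `Covered(u, w)`: the number of positions of `w` lying within some occurrence of `u` in `w`. -/
noncomputable def covered (u w : List A) : ℕ :=
  ((Finset.range w.length).filter fun p => ∃ i ∈ occ u w, i ≤ p ∧ p < i + u.length).card

/-- The smallest element of `X` greater than `x`, and `⊤` if there is none. -/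
noncomputable def nextIn (X : Finset ℕ) (x : ℕ) : ℕ∞ := (X.filter fun y => x < y).min

/-- Distance from the occurrence `i` of `u` in `w` to the next one; `⊤` for the last occurrence. -/
noncomputable def gap (u w : List A) (i : ℕ) : ℕ∞ := nextIn (occ u w) i - (i : ℕ∞)

open Classical in
/-- The annotation `Δ`: the number of occurrences of `u` that do not overlap the next one. -/
noncomputable def delta (u w : List A) : ℕ :=
  ((occ u w).filter fun i => (u.length : ℕ∞) ≤ gap u w i).card

/-- `u` is primitive: it is a power of no word but itself. -/
def Primitive (u : List A) : Prop :=
  ∀ (y : List A) (k : ℕ), u = (List.replicate k y).flatten → y = u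

/-- `u` is a shortest factor of `w` with `Covered(u, w) ≥ α`. -/
def IsShortestPartialCover (α : ℕ) (u w : List A) : Prop :=
  (u <:+: w ∧ α ≤ covered u w) ∧
    ∀ u' : List A, u' <:+: w → α ≤ covered u' w → u.length ≤ u'.length

/-! ### The Cover Suffix Tree -/

/-- `u` has two distinct one-letter right extensions among the factors of `w`. -/
def IsBranching (u w : List A) : Prop :=
  ∃ a b : A, a ≠ b ∧ u ++ [a] <:+: w ∧ u ++ [b] <:+: w

/-- The (inner) explicit nodes of the Cover Suffix Tree of `w`, as words: the explicit nodes of the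
compact trie of the suffixes of `w` (suffixes, including the root `[]`, and branching nodes) and the
extra nodes (halves of primitively rooted squares occurring in `w`). -/
def IsExplicit (u w : List A) : Prop :=
  u <:+ w ∨ IsBranching u w ∨ (Primitive u ∧ u ++ u <:+: w)

/-- A concrete representation of the Cover Suffix Tree of `w`: its explicit nodes are numbered
`0, …, size - 1` in an arbitrary order, each one knows its parent and the start of one occurrence
in `w` (so that the edge labels are fragments of `w`). -/
structure CST (w : List A) where
  /-- the number of explicit nodes -/
  size : ℕ
  /-- the word spelled on the path from the root to a node -/
  word : Fin size → List A
  word_injective : Function.Injective word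
  exists_word_eq_iff : ∀ u : List A, (∃ v, word v = u) ↔ IsExplicit u w
  /-- the parent of a node; the root is its own parent -/
  parent : Fin size → Fin size
  parent_root : ∀ v, word v = [] → parent v = v
  parent_prefix : ∀ v, word v ≠ [] →
    word (parent v) <+: word v ∧ (word (parent v)).length < (word v).length
  parent_longest : ∀ v u : Fin size, word u <+: word v → (word u).length < (word v).length →
    (word u).length ≤ (word (parent v)).length
  /-- the starting position of one occurrence of the word of a node -/
  start : Fin size → ℕ
  start_mem_occ : ∀ v, start v ∈ occ (word v) w

/-- `(v, j)` is the locus of `u`: the node of `u` is the `j`-th one (counted from `0`) on the upward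
path that starts in the explicit node `v` and stops below the parent of `v`. -/
def CST.IsLocus {w : List A} (T : CST w) (v : Fin T.size) (j : ℕ) (u : List A) : Prop :=
  (j = 0 ∨ (T.word (T.parent v)).length + j < (T.word v).length) ∧
    u = (T.word v).take ((T.word v).length - j)

end Words

/-! ### A word RAM

Structured programs over finitely many registers and finitely many arrays of natural numbers. -/

/-- The unit-cost operations on machine words. -/
inductive Op where
  | add | sub | mul | div | mod | lt | eq

/-- The value of an operation (subtraction is truncated, division by zero gives zero,
comparisons give `0` or `1`). -/
def Op.apply : Op → ℕ → ℕ → ℕ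
  | .add, x, y => x + y
  | .sub, x, y => x - y
  | .mul, x, y => x * y
  | .div, x, y => x / y
  | .mod, x, y => x % y
  | .lt, x, y => if x < y then 1 else 0
  | .eq, x, y => if x = y then 1 else 0

/-- The contents of all registers and of all array cells (`mem a i` is cell `i` of array `a`). -/
@[ext] structure State where
  reg : ℕ → ℕ
  mem : ℕ → ℕ → ℕ

def State.setReg (σ : State) (r x : ℕ) : State :=
  { σ with reg := Function.update σ.reg r x }

def State.setMem (σ : State) (a i x : ℕ) : State :=
  { σ with mem := Function.update σ.mem a (Function.update (σ.mem a) i x) }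

/-- Expressions: constants, registers, array cells with a computed index, operations. -/
inductive Expr where
  | lit (x : ℕ)
  | reg (r : ℕ)
  | get (a : ℕ) (i : Expr)
  | bin (o : Op) (e f : Expr)

def Expr.val (σ : State) : Expr → ℕ
  | .lit x => x
  | .reg r => σ.reg r
  | .get a i => σ.mem a (i.val σ)
  | .bin o e f => o.apply (e.val σ) (f.val σ)

/-- The time of evaluating an expression: one step for each constant, access and operation. -/
def Expr.cost : Expr → ℕ
  | .lit _ => 1
  | .reg _ => 1
  | .get _ i => i.cost + 1
  | .bin _ e f => e.cost + f.cost + 1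

/-- The evaluation stays within the machine with `S` cells per array and machine words `< W`. -/
def Expr.Fits (S W : ℕ) (σ : State) : Expr → Prop
  | .lit x => x < W
  | .reg r => σ.reg r < W
  | .get a i => i.Fits S W σ ∧ i.val σ < S ∧ σ.mem a (i.val σ) < W
  | .bin o e f => e.Fits S W σ ∧ f.Fits S W σ ∧ o.apply (e.val σ) (f.val σ) < W

/-- Programs. -/
inductive Prog where
  | skip
  | set (r : ℕ) (e : Expr)
  | put (a : ℕ) (i e : Expr)
  | seq (p q : Prog)
  | ite (e : Expr) (p q : Prog)
  | while (e : Expr) (p : Prog)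

/-- `Exec S W p σ t τ`: started in `σ`, the program `p` halts after `t` steps in `τ`, every array
index that it uses is `< S`, and every number that it reads or computes is `< W`. -/
inductive Exec (S W : ℕ) : Prog → State → ℕ → State → Prop
  | skip (σ : State) : Exec S W .skip σ 1 σ
  | set (σ : State) (r : ℕ) (e : Expr) (he : e.Fits S W σ) :
      Exec S W (.set r e) σ (e.cost + 1) (σ.setReg r (e.val σ))
  | put (σ : State) (a : ℕ) (i e : Expr) (hi : i.Fits S W σ) (he : e.Fits S W σ)
      (hS : i.val σ < S) :
      Exec S W (.put a i e) σ (i.cost + e.cost + 1) (σ.setMem a (i.val σ) (e.val σ))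
  | seq {σ ρ τ : State} {p q : Prog} {s t : ℕ} (hp : Exec S W p σ s ρ) (hq : Exec S W q ρ t τ) :
      Exec S W (.seq p q) σ (s + t) τ
  | ite_true {σ τ : State} {e : Expr} {p : Prog} (q : Prog) {t : ℕ} (he : e.Fits S W σ)
      (h : e.val σ ≠ 0) (hp : Exec S W p σ t τ) : Exec S W (.ite e p q) σ (e.cost + 1 + t) τ
  | ite_false {σ τ : State} {e : Expr} (p : Prog) {q : Prog} {t : ℕ} (he : e.Fits S W σ)
      (h : e.val σ = 0) (hq : Exec S W q σ t τ) : Exec S W (.ite e p q) σ (e.cost + 1 + t) τ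
  | while_false {σ : State} {e : Expr} (p : Prog) (he : e.Fits S W σ) (h : e.val σ = 0) :
      Exec S W (.while e p) σ (e.cost + 1) σ
  | while_true {σ ρ τ : State} {e : Expr} {p : Prog} {s t : ℕ} (he : e.Fits S W σ)
      (h : e.val σ ≠ 0) (hp : Exec S W p σ s ρ) (hw : Exec S W (.while e p) ρ t τ) :
      Exec S W (.while e p) σ (e.cost + 1 + s + t) τ

/-! ### Input and output -/

/-- The array holding `f v` in cell `v` for each node `v`, and `0` in all other cells. -/
def nodeArray {m : ℕ} (f : Fin m → ℕ) : ℕ → ℕ := fun i => if h : i < m then f ⟨i, h⟩ else 0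

/-- The initial state of the machine, given the Cover Suffix Tree of `w`: registers `0` and `1` hold
`|w|` and the number of explicit nodes; arrays `0, …, 4` hold, for each node `v`, its parent, its
depth, the start of one occurrence, `c(v)` and `Δ(v)`; everything else is `0`. -/
noncomputable def CST.input {A : Type*} {w : List A} (T : CST w) : State where
  reg r := match r with
    | 0 => w.length
    | 1 => T.size
    | _ => 0
  mem a := match a with
    | 0 => nodeArray fun v => (T.parent v : ℕ)
    | 1 => nodeArray fun v => (T.word v).length
    | 2 => nodeArray T.start
    | 3 => nodeArray fun v => covered (T.word v) w
    | 4 => nodeArray fun v => delta (T.word v) w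
    | _ => fun _ => 0

/-- In the state `σ`, cell `α` of arrays `5` and `6` holds the locus (explicit node and index on its
upward path) of a shortest `α`-partial cover of `w`. -/
def CST.OutputAt {A : Type*} {w : List A} (T : CST w) (σ : State) (α : ℕ) : Prop :=
  ∃ (v : Fin T.size) (u : List A), σ.mem 5 α = v ∧ T.IsLocus v (σ.mem 6 α) u ∧
    IsShortestPartialCover α u w

end PartialCovers

namespace PartialCovers

/-! ### Periods -/

section Periods

variable {B : Type*}

/-! Strictly inside an edge no word is a suffix or branching, so all words on the edge of `v` have
the occurrences of `v` (`CST.occ_take`). Passing from length l to l + 1 there covers one new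
position for each occurrence whose gap exceeds l. A gap g with l < g < |v| would make the prefix of
`v` of length g a primitive square half, hence an explicit node inside the edge. So the gain is
always Δ(v), and the cover index is the linear function c(v) - Δ(v)(|v| - l) (`CST.covered_take`).
It remains to maximise, for each l, these functions over the edges containing l, and to scan l
upwards: each new record answers the values of α up to it.

The maxima are found slope by slope. Functions of equal slope compare alike at every length, so an
edge amounts to one number (its value continued to length n) placed on an interval of a segment
tree. The occurrences counted by Δ(v) are disjoint, whence Δ(v)|v| ≤ n (`delta_mul_length_le`), and
slope s needs only n / s + 1 leaves. Clearing and reading all the trees thus costs a harmonic sum,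
O(n log n), within one array; inserting an edge costs O(log n).

There are O(n) edges (`CST.size_le`): suffixes and branching words number at most n + 1 each, and at
most two primitive squares have their last occurrence at a given position
(`period_of_three_squares`). A value x of the node v is stored as x * m + v, so that a maximum
carries its maximiser; these numbers are polynomial in n. -/

theorem hasPeriod_map_range_iff {x : ℕ → B} {L p : ℕ} :
    ((List.range L).map x).HasPeriod p ↔ ∀ k, k + p < L → x k = x (k + p) := by
  rw [List.hasPeriod_iff_getElem?]
  constructor
  · intro h k hk
    have := h k (by simp; omega)
    simpa [List.getElem?_range, show k < L by omega, hk] using this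
  · intro h k hk
    simp only [List.length_map, List.length_range] at hk
    have := h k (by omega)
    simp [show k < L by omega, show k + p < L by omega, this]

theorem eq_mod_of_period {x : ℕ → B} {L p : ℕ} (h : ∀ k, k + p < L → x k = x (k + p)) {k : ℕ}
    (hk : k < L) : x k = x (k % p) := by
  have := List.HasPeriod.getElem?_mod p k _ (hasPeriod_map_range_iff.2 h) (by simpa using hk)
  have h' : k % p < L := lt_of_le_of_lt (Nat.mod_le _ _) hk
  simpa [hk, h'] using this.symm

theorem period_gcd {x : ℕ → B} {L p q : ℕ} (hp : ∀ k, k + p < L → x k = x (k + p))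
    (hq : ∀ k, k + q < L → x k = x (k + q)) (hL : p + q ≤ L) :
    ∀ k, k + p.gcd q < L → x k = x (k + p.gcd q) := by
  rw [← hasPeriod_map_range_iff] at *
  exact hp.gcd hq (by simp; omega)

/-- If three squares with halves of lengths `a < b < c < 2 a` start at the same position, then the
half of the shortest one is a proper power. -/
theorem period_of_three_squares {x : ℕ → B} {a b c : ℕ} (hab : a < b) (hbc : b < c)
    (hca : c < 2 * a) (ha : ∀ k < a, x k = x (k + a)) (hb : ∀ k < b, x k = x (k + b))
    (hc : ∀ k < c, x k = x (k + c)) :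
    ∃ g, 0 < g ∧ g < a ∧ g ∣ a ∧ ∀ k, k + g < a → x k = x (k + g) := by
  have va : ∀ k, k + a < b → x k = x (k + a) := fun k hk => ha k (by omega)
  -- Shifting by c and back by b gives the prefix of length b the period c - b; `up` does the same
  -- with b and a.
  have vq : ∀ k, k + (c - b) < b → x k = x (k + (c - b)) := by
    intro k hk
    rw [hc k (by omega), hb (k + (c - b)) hk]
    congr 1; omega
  have up : ∀ k, k + (b - a) < a → x k = x (k + (b - a)) := by
    intro k hk
    rw [hb k (by omega), ha (k + (b - a)) hk]
    congr 1; omega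
  have uq : ∀ k, k + (c - b) < a → x k = x (k + (c - b)) := fun k hk => vq k (by omega)
  -- If the periods a and c - b fit into length b, Fine and Wilf apply at once. Otherwise they apply
  -- first to the prefix of length a, with periods b - a and c - b, whose sum c - a is below a.
  rcases le_or_gt (a + (c - b)) b with h | h
  · have hg := period_gcd va vq h
    have := Nat.gcd_le_right a (show 0 < c - b by omega)
    exact ⟨a.gcd (c - b), Nat.gcd_pos_of_pos_left _ (by omega), by omega, Nat.gcd_dvd_left _ _,
      fun k hk => hg k (by omega)⟩
  · have hg := period_gcd up uq (by omega)
    set g := (b - a).gcd (c - b) with hgdef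
    have hg0 : 0 < g := Nat.gcd_pos_of_pos_left _ (by omega)
    have hgle : g ≤ b - a := Nat.gcd_le_left _ (by omega)
    have hgd : g ∣ c - b := Nat.gcd_dvd_right _ _
    -- As g divides c - b < a, the period g spreads from length a to length b through the period c -
    -- b. There a + g ≤ b, so Fine and Wilf apply again.
    have hmod : ∀ k < b, x k = x (k % g) := by
      intro k hk
      have hlt : k % (c - b) < c - b := Nat.mod_lt _ (by omega)
      rw [eq_mod_of_period vq hk, eq_mod_of_period hg (show k % (c - b) < a by omega),
        Nat.mod_mod_of_dvd _ hgd]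
    have vg : ∀ k, k + g < b → x k = x (k + g) := by
      intro k hk
      rw [hmod k (by omega), hmod (k + g) hk, Nat.add_mod_right]
    have hg' := period_gcd va vg (by omega)
    have := Nat.gcd_le_right a hg0
    exact ⟨a.gcd g, Nat.gcd_pos_of_pos_left _ (by omega), by omega, Nat.gcd_dvd_left _ _,
      fun k hk => hg' k (by omega)⟩

/-- A prefix u of yu that is long enough begins with y; cancelling y leaves a shorter word of the
same kind. -/
theorem eq_flatten_replicate {y : List B} : ∀ {k : ℕ} {u : List B}, u <+: y ++ u →
    u.length = y.length * k → u = (List.replicate k y).flatten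
  | 0, u, _, hl => by simpa using hl
  | k + 1, u, h, hl => by
    have hy : y <+: u := List.prefix_of_prefix_length_le (List.prefix_append y u) h
      (by rw [hl]; exact Nat.le_mul_of_pos_right _ (Nat.succ_pos k))
    obtain ⟨u', rfl⟩ := hy
    have h' := (List.prefix_append_right_inj y).1 h
    have := eq_flatten_replicate (k := k) h' (by simp [Nat.mul_succ] at hl; omega)
    rw [List.replicate_succ, List.flatten_cons, ← this]

theorem Primitive.not_period {u : List B} (hu : Primitive u) {g : ℕ}
    (hg : g < u.length) (hd : g ∣ u.length) : ¬ u.HasPeriod g := by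
  intro h
  obtain ⟨k, hk⟩ := hd
  have hl : (u.take g).length = g := by simp; omega
  have := hu (u.take g) k (eq_flatten_replicate h (by rw [hl, hk]))
  rw [this] at hl
  omega

end Periods

/-! ### Occurrences -/

section Occurrences

variable {A : Type*} {u v w : List A} {i : ℕ}

theorem mem_occ_iff : i ∈ occ u w ↔ i + u.length ≤ w.length ∧ ∀ k < u.length, u[k]? = w[i + k]? := by
  simp only [occ, Finset.mem_filter, Finset.mem_range, List.prefix_iff_getElem?]
  constructor
  · rintro ⟨hi, h⟩
    refine ⟨?_, fun k hk => ?_⟩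
    · have := List.prefix_iff_getElem?.2 h |>.length_le
      simp at this; omega
    · have := h k hk
      rw [List.getElem?_drop] at this
      rw [this, List.getElem?_eq_getElem hk]
  · rintro ⟨hi, h⟩
    refine ⟨by omega, fun k hk => ?_⟩
    rw [List.getElem?_drop, ← h k hk, List.getElem?_eq_getElem hk]

theorem infix_iff_occ : u <:+: w ↔ ∃ i, i ∈ occ u w := by
  simp only [occ, Finset.mem_filter, Finset.mem_range]
  constructor
  · rintro ⟨s, t, rfl⟩
    exact ⟨s.length, by simp, by simp⟩
  · rintro ⟨i, -, h⟩
    exact h.isInfix.trans (List.drop_suffix i w).isInfix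

theorem occ_mono (h : u <+: v) : occ v w ⊆ occ u w := by
  intro i hi
  simp only [occ, Finset.mem_filter] at hi ⊢
  exact ⟨hi.1, h.trans hi.2⟩

theorem eq_of_mem_occ (hu : i ∈ occ u w) (hv : i ∈ occ v w) (h : u.length = v.length) : u = v := by
  simp only [occ, Finset.mem_filter] at hu hv
  exact (List.prefix_of_prefix_length_le hu.2 hv.2 h.le).eq_of_length h

theorem prefix_of_mem_occ (hu : i ∈ occ u w) (hv : i ∈ occ v w) (h : u.length ≤ v.length) :
    u <+: v := by
  simp only [occ, Finset.mem_filter] at hu hv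
  exact List.prefix_of_prefix_length_le hu.2 hv.2 h

theorem mem_occ_append {u v : List A} :
    i ∈ occ (u ++ v) w ↔ i ∈ occ u w ∧ i + u.length ∈ occ v w := by
  simp only [mem_occ_iff, List.length_append]
  constructor
  · rintro ⟨h1, h2⟩
    refine ⟨⟨by omega, fun k hk => ?_⟩, by omega, fun k hk => ?_⟩
    · rw [← h2 k (by omega), List.getElem?_append_left hk]
    · rw [add_assoc, ← h2 _ (by omega), List.getElem?_append_right (by omega)]
      simp
  · rintro ⟨⟨h1, h2⟩, h3, h4⟩
    refine ⟨by omega, fun k hk => ?_⟩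
    rcases lt_or_ge k u.length with h | h
    · rw [List.getElem?_append_left h, h2 k h]
    · rw [List.getElem?_append_right h, h4 _ (by omega)]
      congr 1; omega

theorem le_gap_iff {d : ℕ} : (d : ℕ∞) ≤ gap u w i ↔ ∀ j ∈ occ u w, i < j → i + d ≤ j := by
  unfold gap nextIn
  rcases Finset.eq_empty_or_nonempty ((occ u w).filter fun y => i < y) with h | h
  · simp only [h, Finset.min_empty]
    have : ∀ j ∈ occ u w, ¬ i < j := fun j hj hij => by
      have : j ∈ (occ u w).filter fun y => i < y := by simp [hj, hij]
      simp [h] at this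
    constructor
    · intro _ j hj hij
      exact absurd hij (this j hj)
    · intro _
      change (d : ℕ∞) ≤ ⊤ - (i : ℕ∞)
      simp
  · obtain ⟨x, hx⟩ := Finset.min_of_nonempty h
    have hxm := Finset.mem_of_min hx
    rw [hx]
    change (d : ℕ∞) ≤ ((x : ℕ) : ℕ∞) - ((i : ℕ) : ℕ∞) ↔ _
    rw [← ENat.natCast_sub, Nat.cast_le]
    simp only [Finset.mem_filter] at hxm
    constructor
    · intro hd j hj hij
      have := Finset.min_le_of_eq (s := (occ u w).filter fun y => i < y) (b := j)
        (by simp [hj, hij]) hx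
      omega
    · intro hd
      have := hd x hxm.1 hxm.2
      omega

end Occurrences

/-! ### The number of explicit nodes -/

section Counting

variable {A : Type*} {u u' v w : List A} {i : ℕ}

/-- `i` is the first occurrence of some one-letter extension of `u`, but not of `u` itself. -/
def BranchesAt (w u : List A) (i : ℕ) : Prop :=
  ∃ b : A, i ∈ occ (u ++ [b]) w ∧ (∀ j ∈ occ (u ++ [b]) w, i ≤ j) ∧ ∃ j ∈ occ u w, j < i

/-- Two different extensions of `u` have different first occurrences, and the later one comes after
an occurrence of `u`. -/
theorem IsBranching.exists_branchesAt (h : IsBranching u w) : ∃ i, BranchesAt w u i := by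
  classical
  obtain ⟨a, b, hab, ha, hb⟩ := h
  rw [infix_iff_occ] at ha hb
  have key : ∀ a b : A, a ≠ b → ∀ (ha : ∃ i, i ∈ occ (u ++ [a]) w)
      (hb : ∃ i, i ∈ occ (u ++ [b]) w), Nat.find ha ≤ Nat.find hb →
      ∃ i, BranchesAt w u i := by
    intro a b hab ha hb hle
    refine ⟨Nat.find hb, b, Nat.find_spec hb, fun j hj => Nat.find_min' hb hj,
      Nat.find ha, (mem_occ_append.1 (Nat.find_spec ha)).1, lt_of_le_of_ne hle fun he => hab ?_⟩
    have h1 := Nat.find_spec ha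
    rw [he] at h1
    have := eq_of_mem_occ h1 (Nat.find_spec hb) (by simp)
    simpa using this
  rcases le_total (Nat.find ha) (Nat.find hb) with h | h
  · exact key a b hab ha hb h
  · exact key b a hab.symm hb ha h

/-- If `u` were shorter than `u'`, the extension of `u` at `i` would be a prefix of `u'`, and the
earlier occurrence of `u'` would contain it before its first occurrence. -/
theorem BranchesAt.unique (h : BranchesAt w u i) (h' : BranchesAt w u' i) : u = u' := by
  have key : ∀ u u' : List A, BranchesAt w u i → BranchesAt w u' i →
      ¬ u.length < u'.length := by
    rintro u u' ⟨b, h1, h2, -⟩ ⟨b', h1', -, j, hj, hji⟩ hlt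
    have hp : u ++ [b] <+: u' := prefix_of_mem_occ h1 (mem_occ_append.1 h1').1 (by simpa using hlt)
    have := h2 j (occ_mono hp hj)
    omega
  have hl : u.length = u'.length :=
    le_antisymm (not_lt.1 (key _ _ h' h)) (not_lt.1 (key _ _ h h'))
  obtain ⟨b, h1, -⟩ := h
  obtain ⟨b', h1', -⟩ := h'
  exact eq_of_mem_occ (mem_occ_append.1 h1).1 (mem_occ_append.1 h1').1 hl

/-- `i` is the last occurrence of the square of the nonempty primitive word `u`. -/
def LastSquareAt (w u : List A) (i : ℕ) : Prop :=
  Primitive u ∧ u ≠ [] ∧ i ∈ occ (u ++ u) w ∧ ∀ j ∈ occ (u ++ u) w, j ≤ i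

theorem exists_lastSquareAt (hu : Primitive u) (hne : u ≠ []) (h : u ++ u <:+: w) :
    ∃ i, LastSquareAt w u i := by
  rw [infix_iff_occ] at h
  exact ⟨(occ (u ++ u) w).max' h, hu, hne, Finset.max'_mem _ _, fun j hj => Finset.le_max' _ _ hj⟩

theorem LastSquareAt.length_lt (h : LastSquareAt w u i) : i < w.length := by
  have := (mem_occ_iff.1 h.2.2.1).1
  have := List.length_pos_iff.2 h.2.1
  simp at *; omega

theorem getElem?_eq_of_square (h : i ∈ occ (u ++ u) w) {k : ℕ} (hk : k < u.length) :
    w[i + k]? = w[i + (k + u.length)]? := by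
  have h' := mem_occ_append.1 h
  rw [← (mem_occ_iff.1 h'.1).2 k hk, (mem_occ_iff.1 h'.2).2 k hk]
  congr 1; omega

/-- If |v| ≥ 2|u|, then uu is a prefix of v and occurs again with the second half of vv, so its
occurrence at `i` is not the last. Otherwise the three squares give `u` a period properly dividing
its length, against primitivity. -/
theorem not_three_lastSquareAt (hu : LastSquareAt w u i) (hu' : LastSquareAt w u' i)
    (hv : LastSquareAt w v i) (h1 : u.length < u'.length) (h2 : u'.length < v.length) : False := by
  rcases lt_or_ge v.length (2 * u.length) with h | h
  · obtain ⟨g, hg0, hg, hd, hp⟩ := period_of_three_squares (x := fun k => w[i + k]?) h1 h2 h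
      (fun k hk => getElem?_eq_of_square hu.2.2.1 hk)
      (fun k hk => getElem?_eq_of_square hu'.2.2.1 hk)
      (fun k hk => getElem?_eq_of_square hv.2.2.1 hk)
    refine hu.1.not_period hg hd (List.hasPeriod_iff_getElem?.2 fun k hk => ?_)
    have ho := (mem_occ_iff.1 (mem_occ_append.1 hu.2.2.1).1).2
    rw [ho k (by omega), ho (k + g) (by omega)]
    exact hp k (by omega)
  · have hvv := mem_occ_append.1 hv.2.2.1
    have hp : u ++ u <+: v := prefix_of_mem_occ hu.2.2.1 hvv.1 (by simp; omega)
    have := hu.2.2.2 _ (occ_mono hp hvv.2)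
    omega

/-- The relation between the explicit nodes of the Cover Suffix Tree and their keys. -/
def IsKey (w u : List A) (i : ℕ) : ℕ → Prop
  | 0 => u = w.drop i
  | 1 => BranchesAt w u i
  | 2 => LastSquareAt w u i ∧ ∃ u', LastSquareAt w u' i ∧ u'.length < u.length
  | _ => LastSquareAt w u i ∧ ¬ ∃ u', LastSquareAt w u' i ∧ u'.length < u.length

theorem IsExplicit.exists_isKey (h : IsExplicit u w) :
    ∃ i t, i < w.length + 1 ∧ t < 4 ∧ IsKey w u i t := by
  by_cases hs : u <:+ w
  · obtain ⟨s, rfl⟩ := hs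
    exact ⟨s.length, 0, by simp, by norm_num, by simp [IsKey]⟩
  rcases h with h | h | ⟨h, h'⟩
  · exact absurd h hs
  · obtain ⟨i, hi⟩ := h.exists_branchesAt
    obtain ⟨b, hb, -⟩ := id hi
    have := (mem_occ_iff.1 hb).1
    exact ⟨i, 1, by omega, by norm_num, hi⟩
  · have hne : u ≠ [] := by
      rintro rfl
      exact hs (List.nil_suffix)
    obtain ⟨i, hi⟩ := exists_lastSquareAt h hne h'
    have := hi.length_lt
    by_cases hq : ∃ u', LastSquareAt w u' i ∧ u'.length < u.length
    · exact ⟨i, 2, by omega, by norm_num, hi, hq⟩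
    · exact ⟨i, 3, by omega, by norm_num, hi, hq⟩

theorem LastSquareAt.eq_of_length (h : LastSquareAt w u i) (h' : LastSquareAt w u' i)
    (hl : u.length = u'.length) : u = u' :=
  eq_of_mem_occ (mem_occ_append.1 h.2.2.1).1 (mem_occ_append.1 h'.2.2.1).1 hl

theorem IsKey.unique : ∀ {t : ℕ}, IsKey w u i t → IsKey w u' i t → u = u'
  | 0, h, h' => Eq.trans h (Eq.symm h')
  | 1, h, h' => BranchesAt.unique h h'
  | 2, ⟨h, x, hx, hxu⟩, ⟨h', y, hy, hyu⟩ => by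
    rcases lt_trichotomy u.length u'.length with hl | hl | hl
    · exact (not_three_lastSquareAt hx h h' hxu hl).elim
    · exact h.eq_of_length h' hl
    · exact (not_three_lastSquareAt hy h' h hyu hl).elim
  | t + 3, ⟨h, hn⟩, ⟨h', hn'⟩ => by
    rcases lt_trichotomy u.length u'.length with hl | hl | hl
    · exact (hn' ⟨u, h, hl⟩).elim
    · exact h.eq_of_length h' hl
    · exact (hn ⟨u', h', hl⟩).elim

/-- A position and one of four kinds determine an explicit node: suffix, branching word, or the
longer or shorter of the two possible last squares. -/
theorem CST.size_le (T : CST w) : T.size ≤ 4 * (w.length + 1) := by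
  have hk : ∀ v, ∃ i t, i < w.length + 1 ∧ t < 4 ∧ IsKey w (T.word v) i t := fun v =>
    ((T.exists_word_eq_iff _).1 ⟨v, rfl⟩).exists_isKey
  choose f g hf hg hfg using hk
  have hinj : Function.Injective fun v : Fin T.size =>
      ((⟨g v, hg v⟩, ⟨f v, hf v⟩) : Fin 4 × Fin (w.length + 1)) := by
    intro v v' h
    simp only [Prod.mk.injEq, Fin.mk.injEq] at h
    have h1 := hfg v
    rw [h.1, h.2] at h1
    exact T.word_injective (h1.unique (hfg v'))
  simpa using Fintype.card_le_of_injective _ hinj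

end Counting

/-! ### The cover index along an edge -/

section Edges

variable {A : Type*} {u v w : List A} {i : ℕ}

theorem covered_le (u w : List A) : covered u w ≤ w.length := by
  classical
  exact (Finset.card_filter_le _ _).trans (by simp)

theorem covered_nil (w : List A) : covered [] w = 0 := by
  classical
  simp only [covered, Finset.card_eq_zero, Finset.filter_eq_empty_iff]
  rintro p - ⟨i, -, h1, h2⟩
  simp at h2; omega

theorem covered_self (w : List A) : covered w w = w.length := by
  classical
  unfold covered
  rw [Finset.filter_true_of_mem, Finset.card_range]
  intro p hp
  exact ⟨0, mem_occ_iff.2 ⟨by simp, by simp⟩, by simp, by simpa using hp⟩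

/-- An occurrence of a non-suffix is followed by a letter; a letter other than `v[l]` would make the
prefix branching. -/
theorem mem_occ_of_not_branching {l : ℕ} (hl : l < v.length) (hv : v <:+: w)
    (hs : ¬ v.take l <:+ w) (hb : ¬ IsBranching (v.take l) w) (hi : i ∈ occ (v.take l) w) :
    i ∈ occ (v.take (l + 1)) w := by
  have hlen : (v.take l).length = l := by simp; omega
  obtain ⟨hi1, hi2⟩ := mem_occ_iff.1 hi
  rw [hlen] at hi1 hi2
  have hlt : i + l < w.length := by
    refine lt_of_le_of_ne hi1 fun he => hs ?_
    have h1 : v.take l <+: w.drop i := by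
      simp only [occ, Finset.mem_filter] at hi
      exact hi.2
    rw [h1.eq_of_length (by simp; omega)]
    exact List.drop_suffix i w
  have h1 : i ∈ occ (v.take l ++ [w[i + l]]) w := by
    rw [mem_occ_append, hlen]
    exact ⟨hi, mem_occ_iff.2 ⟨by simp; omega, by simp [hlt]⟩⟩
  rw [List.take_add_one, List.getElem?_eq_getElem hl]
  simp only [Option.toList]
  by_cases he : v[l] = w[i + l]
  · rwa [he]
  · refine absurd ⟨v[l], w[i + l], he, ?_, infix_iff_occ.2 ⟨i, h1⟩⟩ hb
    have : v.take l ++ [v[l]] = v.take (l + 1) := by simp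
    rw [this]
    exact (List.take_prefix _ _).isInfix.trans hv

theorem CST.not_isExplicit {T : CST w} {v : Fin T.size} {l : ℕ}
    (h1 : (T.word (T.parent v)).length < l) (h2 : l < (T.word v).length) :
    ¬ IsExplicit ((T.word v).take l) w := by
  intro h
  obtain ⟨x, hx⟩ := (T.exists_word_eq_iff _).2 h
  have hl : ((T.word v).take l).length = l := by simp; omega
  have := T.parent_longest v x (hx ▸ List.take_prefix _ _) (by rw [hx, hl]; exact h2)
  rw [hx, hl] at this
  omega

theorem CST.word_infix (T : CST w) (v : Fin T.size) : T.word v <:+: w :=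
  infix_iff_occ.2 ⟨_, T.start_mem_occ v⟩

theorem CST.occ_take {T : CST w} {v : Fin T.size} {l : ℕ}
    (h1 : (T.word (T.parent v)).length < l) (h2 : l ≤ (T.word v).length) :
    occ ((T.word v).take l) w = occ (T.word v) w := by
  induction h2 using Nat.decreasingInduction with
  | self => simp
  | of_succ l hl ih =>
    have hne := T.not_isExplicit h1 hl
    rw [IsExplicit] at hne
    push Not at hne
    rw [← ih (by omega)]
    refine subset_antisymm (fun i hi => ?_) (occ_mono (List.take_prefix_take_left (Nat.le_succ l)))
    exact mem_occ_of_not_branching hl (T.word_infix v) hne.1 hne.2.1 hi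

/-- If `u` and `u` shifted by `g` occur in `w` with no occurrence of `u` in between, then the prefix
of `u` of length `g` is primitive. -/
theorem primitive_take {g l : ℕ} (hl : l < g) (hgu : g < u.length)
    (hocc : occ (u.take l) w = occ u w)
    (hi : i ∈ occ u w) (hj : i + g ∈ occ u w) (hno : ∀ j ∈ occ u w, i < j → i + g ≤ j) :
    Primitive (u.take g) := by
  intro y k hk
  have hglen : (u.take g).length = g := by simp; omega
  match k, hk with
  | 0, hk => simp [hk] at hglen; omega
  | 1, hk => simpa using hk.symm
  | k + 2, hk =>
    exfalso
    have hy : 0 < y.length := by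
      rcases Nat.eq_zero_or_pos y.length with h | h
      · rw [List.length_eq_zero_iff] at h
        simp [hk, h] at hglen; omega
      · exact h
    have hsq : i ∈ occ (u.take g ++ u.take g) w := by
      rw [mem_occ_append, hglen]
      exact ⟨occ_mono (List.take_prefix _ _) hi, occ_mono (List.take_prefix _ _) hj⟩
    -- The square of a proper power of y contains the root once more, shifted by |y|.
    have hrot : u.take g ++ u.take g = y ++ (u.take g ++ (List.replicate (k + 1) y).flatten) := by
      have h1 : u.take g = y ++ (List.replicate (k + 1) y).flatten := by
        rw [hk, List.replicate_succ, List.flatten_cons]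
      have h2 : u.take g = (List.replicate (k + 1) y).flatten ++ y := by
        rw [hk, List.replicate_succ', List.flatten_append]; simp
      calc u.take g ++ u.take g
          = (y ++ (List.replicate (k + 1) y).flatten) ++ (y ++ (List.replicate (k + 1) y).flatten) := by
            rw [← h1]
        _ = y ++ (((List.replicate (k + 1) y).flatten ++ y) ++ (List.replicate (k + 1) y).flatten) := by
            simp
        _ = _ := by rw [← h2]
    rw [hrot, mem_occ_append, mem_occ_append] at hsq
    -- The shifted copy has length g > l, so it contains the prefix of length l, and every
    -- occurrence of that prefix extends to one of `u`.
    have h3 : i + y.length ∈ occ u w := by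
      rw [← hocc]
      refine occ_mono ?_ hsq.2.1
      exact List.take_prefix_take_left hl.le
    have h4 := hno _ h3 (by omega)
    have h5 : g = y.length * (k + 2) := by
      rw [← hglen, hk]; simp [mul_comm]
    nlinarith

/-- Were the next occurrence at a distance g with l < g < |v|, the prefix of length g would be a
primitive square half, hence an explicit node strictly between `v` and its parent. -/
theorem CST.add_length_le_of_succ_le {T : CST w} {v : Fin T.size} {l : ℕ}
    (h1 : (T.word (T.parent v)).length < l) (h2 : l < (T.word v).length)
    (hi : i ∈ occ (T.word v) w) (hgap : ∀ j ∈ occ (T.word v) w, i < j → i + (l + 1) ≤ j) :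
    ∀ j ∈ occ (T.word v) w, i < j → i + (T.word v).length ≤ j := by
  classical
  by_contra! hc
  obtain ⟨j, hj, hij, hjlt⟩ := hc
  have hex : ∃ j, j ∈ occ (T.word v) w ∧ i < j := ⟨j, hj, hij⟩
  set z := Nat.find hex with hz
  have hzs := Nat.find_spec hex
  rw [← hz] at hzs
  have hzj : z ≤ j := Nat.find_min' hex ⟨hj, hij⟩
  have hzl := hgap z hzs.1 hzs.2
  obtain ⟨g, hg⟩ := Nat.exists_eq_add_of_lt hzs.2
  rw [hg, add_assoc] at hzs hzj hzl
  have hg2 : g + 1 < (T.word v).length := by omega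
  refine T.not_isExplicit (l := g + 1) (by omega) hg2 (Or.inr (Or.inr ⟨?_, ?_⟩))
  · exact primitive_take (l := l) (by omega) hg2 (T.occ_take h1 h2.le) hi hzs.1
      fun j' hj' hij' => by
        rw [← add_assoc, ← hg]; exact Nat.find_min' hex ⟨hj', hij'⟩
  · have hlen : ((T.word v).take (g + 1)).length = g + 1 := by simp; omega
    exact infix_iff_occ.2 ⟨i, mem_occ_append.2 ⟨occ_mono (List.take_prefix _ _) hi,
      occ_mono (List.take_prefix _ _) (by rw [hlen]; exact hzs.1)⟩⟩

/-- The newly covered positions are i + l for the occurrences i whose gap exceeds l; by the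
preceding lemma this gap is then at least |v|, so they are counted by Δ(v). -/
theorem CST.covered_take_succ {T : CST w} {v : Fin T.size} {l : ℕ}
    (h1 : (T.word (T.parent v)).length < l) (h2 : l < (T.word v).length) :
    covered ((T.word v).take (l + 1)) w = covered ((T.word v).take l) w + delta (T.word v) w := by
  classical
  have hl : ((T.word v).take l).length = l := by simp; omega
  have hl' : ((T.word v).take (l + 1)).length = l + 1 := by simp; omega
  unfold covered delta
  rw [T.occ_take h1 h2.le, T.occ_take (l := l + 1) (by omega) h2, hl, hl',
    ← Finset.card_image_of_injective ((occ (T.word v) w).filter _) (add_left_injective l),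
    ← Finset.card_union_of_disjoint]
  · congr 1
    ext p
    simp only [Finset.mem_union, Finset.mem_filter, Finset.mem_range, Finset.mem_image, le_gap_iff]
    constructor
    · rintro ⟨hp, i, hi, hip, hpi⟩
      by_cases hc : ∃ i ∈ occ (T.word v) w, i ≤ p ∧ p < i + l
      · exact Or.inl ⟨hp, hc⟩
      · right
        refine ⟨i, ⟨hi, T.add_length_le_of_succ_le h1 h2 hi fun j hj hij => ?_⟩, ?_⟩
        · push Not at hc
          have := hc j hj
          have := hc i hi hip
          omega
        · push Not at hc
          have := hc i hi hip
          omega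
    · rintro (⟨hp, i, hi, hip, hpi⟩ | ⟨i, ⟨hi, -⟩, rfl⟩)
      · exact ⟨hp, i, hi, hip, by omega⟩
      · have := (mem_occ_iff.1 hi).1
        exact ⟨by omega, i, hi, by omega, by omega⟩
  · rw [Finset.disjoint_left]
    simp only [Finset.mem_filter, Finset.mem_range, Finset.mem_image, le_gap_iff, not_exists, not_and]
    rintro p ⟨hp, i, hi, hip, hpi⟩ j ⟨hj, hgap⟩ rfl
    have := hgap i hi
    omega

theorem CST.covered_take {T : CST w} {v : Fin T.size} {l : ℕ}
    (h1 : (T.word (T.parent v)).length < l) (h2 : l ≤ (T.word v).length) :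
    covered ((T.word v).take l) w + delta (T.word v) w * ((T.word v).length - l) =
      covered (T.word v) w := by
  induction h2 using Nat.decreasingInduction with
  | self => simp
  | of_succ l hl ih =>
    rw [← ih (by omega), T.covered_take_succ h1 hl,
      show (T.word v).length - l = (T.word v).length - (l + 1) + 1 by omega]
    ring

/-- The bound is attained by the empty word, all of whose n + 1 occurrences count. -/
theorem delta_le (u w : List A) : delta u w ≤ w.length + 1 := by
  classical
  exact (Finset.card_filter_le _ _).trans ((Finset.card_filter_le _ _).trans (by simp))

theorem delta_pos (h : u <:+: w) : 0 < delta u w := by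
  classical
  rw [infix_iff_occ] at h
  refine Finset.card_pos.2 ⟨(occ u w).max' h, ?_⟩
  simp only [Finset.mem_filter, le_gap_iff]
  refine ⟨Finset.max'_mem _ _, fun j hj hlt => absurd (Finset.le_max' _ j hj) (by omega)⟩

/-- The counted occurrences are pairwise disjoint, so (i, k) ↦ i + k is injective. This confines the
edges of slope s to lengths at most n / s. -/
theorem delta_mul_length_le (u w : List A) : delta u w * u.length ≤ w.length := by
  classical
  unfold delta
  rw [← Finset.card_range u.length, ← Finset.card_product, ← Finset.card_range w.length]
  refine Finset.card_le_card_of_injOn (fun p => p.1 + p.2) ?_ ?_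
  · rintro ⟨i, k⟩ h
    simp only [Finset.coe_product, Set.mem_prod, Finset.mem_coe, Finset.mem_filter,
      Finset.mem_range] at h ⊢
    have := (mem_occ_iff.1 h.1.1).1
    omega
  · rintro ⟨i, k⟩ h ⟨i', k'⟩ h' he
    simp only [Finset.coe_product, Set.mem_prod, Finset.mem_coe, Finset.mem_filter,
      Finset.mem_range, le_gap_iff] at h h' he
    have h1 := h.1.2 i' h'.1.1
    have h2 := h'.1.2 i h.1.1
    have : i = i' := by
      rw [Finset.card_range] at *
      omega
    subst this
    simp; omega

/-- Take the shortest explicit word with prefix `u`; there is one because `u` extends to a suffix of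
`w`. -/
theorem CST.exists_edge (T : CST w) (hu : u <:+: w) (hne : u ≠ []) :
    ∃ v : Fin T.size, (T.word (T.parent v)).length < u.length ∧ u.length ≤ (T.word v).length ∧
      u = (T.word v).take u.length := by
  classical
  obtain ⟨s, t, rfl⟩ := hu
  obtain ⟨x, hx⟩ := (T.exists_word_eq_iff (u ++ t)).2 (Or.inl ⟨s, by simp⟩)
  have hex : ∃ l, ∃ v, (T.word v).length = l ∧ u <+: T.word v :=
    ⟨_, x, rfl, hx ▸ List.prefix_append u t⟩
  obtain ⟨v, hvl, hv⟩ := Nat.find_spec hex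
  have hne' : T.word v ≠ [] := by
    intro h
    rw [h, List.prefix_nil] at hv
    exact hne hv
  refine ⟨v, ?_, hv.length_le, List.prefix_iff_eq_take.1 hv⟩
  by_contra! hc
  obtain ⟨hp, hlt⟩ := T.parent_prefix v hne'
  exact Nat.find_min hex (m := (T.word (T.parent v)).length) (by omega)
    ⟨T.parent v, rfl, List.prefix_of_prefix_length_le hv hp hc⟩

end Edges

/-! ### Total correctness with time bounds -/

section Hoare

variable {S W : ℕ} {σ : State} {p q : Prog} {Q R : State → Prop} {T T' T₁ T₂ : ℕ}

@[simp] theorem State.setReg_reg (σ : State) (r x r' : ℕ) :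
    (σ.setReg r x).reg r' = if r' = r then x else σ.reg r' := by
  simp [State.setReg, Function.update_apply]

@[simp] theorem State.setReg_mem (σ : State) (r x : ℕ) : (σ.setReg r x).mem = σ.mem := rfl

@[simp] theorem State.setMem_reg (σ : State) (a i x : ℕ) : (σ.setMem a i x).reg = σ.reg := rfl

@[simp] theorem State.setMem_mem (σ : State) (a i x a' : ℕ) :
    (σ.setMem a i x).mem a' = if a' = a then Function.update (σ.mem a) i x else σ.mem a' := by
  simp [State.setMem, Function.update_apply]

/-- Started in `σ`, the program `p` halts after at most `T` steps in a state satisfying `Q`. -/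
def Ends (S W : ℕ) (p : Prog) (σ : State) (T : ℕ) (Q : State → Prop) : Prop :=
  ∃ t τ, Exec S W p σ t τ ∧ t ≤ T ∧ Q τ

theorem Ends.mono (h : Ends S W p σ T Q) (hT : T ≤ T') (hQ : ∀ τ, Q τ → R τ) :
    Ends S W p σ T' R := by
  obtain ⟨t, τ, h, ht, hτ⟩ := h
  exact ⟨t, τ, h, ht.trans hT, hQ τ hτ⟩

theorem Ends.set {r : ℕ} {e : Expr} (he : e.Fits S W σ) (hT : e.cost + 1 ≤ T)
    (hQ : Q (σ.setReg r (e.val σ))) : Ends S W (.set r e) σ T Q :=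
  ⟨_, _, .set σ r e he, hT, hQ⟩

theorem Ends.put {a : ℕ} {i e : Expr} (hi : i.Fits S W σ) (he : e.Fits S W σ) (hS : i.val σ < S)
    (hT : i.cost + e.cost + 1 ≤ T) (hQ : Q (σ.setMem a (i.val σ) (e.val σ))) :
    Ends S W (.put a i e) σ T Q :=
  ⟨_, _, .put σ a i e hi he hS, hT, hQ⟩

theorem Ends.seq (h : Ends S W p σ T₁ fun ρ => Ends S W q ρ T₂ Q) (hT : T₁ + T₂ ≤ T) :
    Ends S W (.seq p q) σ T Q := by
  obtain ⟨s, ρ, h, hs, t, τ, h', ht, hτ⟩ := h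
  exact ⟨_, _, .seq h h', by omega, hτ⟩

theorem Ends.set_seq {r : ℕ} {e : Expr} (he : e.Fits S W σ) (hT : e.cost + 1 ≤ T)
    (h : Ends S W q (σ.setReg r (e.val σ)) (T - (e.cost + 1)) Q) :
    Ends S W (.seq (.set r e) q) σ T Q :=
  .seq (.set he le_rfl h) (by omega)

theorem Ends.put_seq {a : ℕ} {i e : Expr} (hi : i.Fits S W σ) (he : e.Fits S W σ)
    (hS : i.val σ < S) (hT : i.cost + e.cost + 1 ≤ T)
    (h : Ends S W q (σ.setMem a (i.val σ) (e.val σ)) (T - (i.cost + e.cost + 1)) Q) :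
    Ends S W (.seq (.put a i e) q) σ T Q :=
  .seq (.put hi he hS le_rfl h) (by omega)

/-- Φ is a potential paying for the rest of the run, including the last, failing test. The time T of
a round may depend on the state, which permits amortised bounds. -/
theorem Ends.while {γ : Type*} {e : Expr} (I : γ → State → Prop) (Φ : γ → ℕ)
    (hfit : ∀ g σ, I g σ → e.Fits S W σ) (hpos : ∀ g σ, I g σ → e.cost + 1 ≤ Φ g)
    (hstep : ∀ g σ, I g σ → e.val σ ≠ 0 → ∃ T, Ends S W p σ T fun τ =>
      ∃ g', I g' τ ∧ e.cost + 1 + T + Φ g' ≤ Φ g) {g : γ} (hI : I g σ) :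
    Ends S W (.while e p) σ (Φ g) fun τ => ∃ g', I g' τ ∧ e.val τ = 0 := by
  induction hn : Φ g using Nat.strong_induction_on generalizing g σ with
  | _ n ih =>
    subst hn
    by_cases h0 : e.val σ = 0
    · exact ⟨_, _, .while_false p (hfit g σ hI) h0, hpos g σ hI, g, hI, h0⟩
    · obtain ⟨T, s, ρ, hs, hsT, g', hI', hle⟩ := hstep g σ hI h0
      obtain ⟨t, τ, ht, htΦ, hτ⟩ := ih (Φ g') (by omega) hI' rfl
      exact ⟨_, _, .while_true (hfit g σ hI) h0 hs ht, by omega, hτ⟩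

/-- Repeat `p` and increase the register `r`, as long as it is below `e`. -/
def Prog.upTo (r : ℕ) (e : Expr) (p : Prog) : Prog :=
  .while (.bin .lt (.reg r) e) (.seq p (.set r (.bin .add (.reg r) (.lit 1))))

/-- A test costs `e.cost + 3` and an increment 4; the last test fails and is paid separately. -/
theorem Ends.upTo {r : ℕ} {e : Expr} {b : ℕ} (I : ℕ → State → Prop) (f : ℕ → ℕ) (hb : b + 1 < W)
    (hinv : ∀ i σ, I i σ → i ≤ b ∧ σ.reg r = i ∧ e.val σ = b ∧ e.Fits S W σ)
    (hstep : ∀ i σ, I i σ → i < b → Ends S W p σ (f i) fun τ =>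
      τ.reg r = i ∧ I (i + 1) (τ.setReg r (i + 1))) {a : ℕ} (hI : I a σ) :
    Ends S W (.upTo r e p) σ (∑ i ∈ Finset.Ico a b, (f i + (e.cost + 7)) + (e.cost + 3)) (I b) := by
  refine (Ends.while (p := .seq p (.set r (.bin .add (.reg r) (.lit 1)))) I
    (fun i => ∑ i ∈ Finset.Ico i b, (f i + (e.cost + 7)) + (e.cost + 3)) ?_ ?_ ?_ hI).mono le_rfl ?_
  · intro i σ h
    obtain ⟨h1, h2, h3, h4⟩ := hinv i σ h
    refine ⟨?_, h4, ?_⟩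
    · simp only [Expr.Fits]; omega
    · simp only [Op.apply]; split_ifs <;> omega
  · intro i σ h
    simp only [Expr.cost]; omega
  · intro i σ h h0
    obtain ⟨h1, h2, h3, h4⟩ := hinv i σ h
    have hlt : i < b := by
      simp only [Expr.val, Op.apply, h2, h3] at h0
      by_contra hc
      simp [hc] at h0
    refine ⟨f i + 4, Ends.seq ((hstep i σ h hlt).mono le_rfl ?_) le_rfl⟩
    rintro τ ⟨hr, hI'⟩
    refine Ends.set ?_ le_rfl ⟨i + 1, ?_, ?_⟩
    · simp only [Expr.Fits, Op.apply, Expr.val, hr]; omega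
    · simpa only [Expr.val, Op.apply, hr] using hI'
    · rw [Finset.sum_eq_sum_Ico_succ_bot hlt]
      simp only [Expr.cost]; omega
  · rintro τ ⟨i, hi, h0⟩
    obtain ⟨h1, h2, h3, h4⟩ := hinv i τ hi
    have : ¬ i < b := by
      intro hc
      simp [Expr.val, Op.apply, h2, h3, hc] at h0
    rwa [show b = i by omega]

end Hoare

/-! ### Sums -/

/-- Each dyadic block of values of s contributes at most n. -/
theorem sum_div_Ico_two_pow_le (n k : ℕ) : ∑ s ∈ Finset.Ico 1 (2 ^ k), n / s ≤ n * k := by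
  induction k with
  | zero => simp
  | succ k ih =>
    rw [← Finset.sum_Ico_consecutive _ Nat.one_le_two_pow
      (Nat.pow_le_pow_right two_pos (Nat.le_succ k))]
    have : ∑ s ∈ Finset.Ico (2 ^ k) (2 ^ (k + 1)), n / s ≤ n := by
      calc _ ≤ ∑ s ∈ Finset.Ico (2 ^ k) (2 ^ (k + 1)), n / 2 ^ k :=
            Finset.sum_le_sum fun s hs =>
              Nat.div_le_div_left (Finset.mem_Ico.1 hs).1 (Nat.two_pow_pos k)
        _ = 2 ^ k * (n / 2 ^ k) := by
            rw [Finset.sum_const, Nat.card_Ico, smul_eq_mul, pow_succ]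
            congr 1; omega
        _ ≤ n := Nat.mul_div_le n (2 ^ k)
    exact (Nat.add_le_add ih this).trans (Nat.mul_succ n k).ge

theorem sum_div_le (n : ℕ) : ∑ s ∈ Finset.Ico 1 (n + 1), n / s ≤ n * (Nat.log 2 n + 1) :=
  (Finset.sum_le_sum_of_subset (Finset.Ico_subset_Ico_right
    (Nat.lt_pow_succ_log_self one_lt_two n))).trans (sum_div_Ico_two_pow_le n _)

/-! ### The program -/

section Program

/-- The expression for the larger one of the values of `e` and `f`. -/
def Expr.max (e f : Expr) : Expr := .bin .add e (.bin .sub f e)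

theorem Expr.val_max {σ : State} (e f : Expr) :
    (e.max f).val σ = Max.max (e.val σ) (f.val σ) := by
  simp only [Expr.max, Expr.val, Op.apply]; omega

theorem Expr.fits_max {σ : State} {S W : ℕ} {e f : Expr} (he : e.Fits S W σ) (hf : f.Fits S W σ)
    (he' : e.val σ < W) (hf' : f.val σ < W) : (e.max f).Fits S W σ := by
  refine ⟨he, ⟨hf, he, ?_⟩, ?_⟩ <;> simp only [Expr.val, Op.apply] <;> omega

/-- Link each node `v` to the front of the list with the number `Δ(v)` (arrays `7` and `8`). -/
def buildLists : Prog :=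
  .upTo 2 (.reg 1) (.seq (.put 8 (.reg 2) (.get 7 (.get 4 (.reg 2))))
    (.put 7 (.get 4 (.reg 2)) (.bin .add (.reg 2) (.lit 1))))

/-- Clear the segment tree (array `9`) with `reg 3` leaves. -/
def clearTree : Prog :=
  .upTo 4 (.bin .add (.reg 3) (.reg 3)) (.put 9 (.reg 4) (.lit 0))

/-- Raise canonical nodes of the segment tree that cover the leaves in `[reg 6, reg 7)` to `reg 8`. -/
def markInterval : Prog :=
  .while (.bin .lt (.reg 6) (.reg 7))
    (.seq (.put 9 (.reg 6) ((Expr.get 9 (.reg 6)).max (.reg 8)))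
    (.seq (.put 9 (.bin .sub (.reg 7) (.lit 1))
      ((Expr.get 9 (.bin .sub (.reg 7) (.lit 1))).max (.reg 8)))
    (.seq (.set 6 (.bin .div (.bin .add (.reg 6) (.lit 1)) (.lit 2)))
      (.set 7 (.bin .div (.reg 7) (.lit 2))))))

/-- Compute the range of leaves and the value for the edge that ends in the node `reg 5 - 1`. -/
def loadEdge : Prog :=
  .seq (.set 5 (.bin .sub (.reg 5) (.lit 1)))
  (.seq (.set 6 (.bin .add (.bin .add (.get 1 (.get 0 (.reg 5))) (.lit 1)) (.reg 3)))
  (.seq (.set 7 (.bin .add (.bin .add (.get 1 (.reg 5)) (.lit 1)) (.reg 3)))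
  (.set 8 (.bin .add (.bin .mul (.bin .add (.get 3 (.reg 5))
      (.bin .mul (.reg 2) (.bin .sub (.reg 0) (.get 1 (.reg 5))))) (.reg 1)) (.reg 5)))))

/-- Walk along the list with the number `reg 2` and insert the edges of its nodes into the segment
tree. -/
def insertEdges : Prog :=
  .seq (.set 5 (.get 7 (.reg 2)))
    (.while (.reg 5) (.seq loadEdge (.seq markInterval (.set 5 (.get 8 (.reg 5))))))

/-- Push the values in the segment tree down to the leaves, and update the maxima (array `10`). -/
def pushDown : Prog :=
  .upTo 4 (.bin .add (.reg 3) (.reg 3))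
    (.seq (.put 9 (.reg 4) ((Expr.get 9 (.reg 4)).max (.get 9 (.bin .div (.reg 4) (.lit 2)))))
      (.put 10 (.bin .sub (.reg 4) (.reg 3))
        ((Expr.get 10 (.bin .sub (.reg 4) (.reg 3))).max
          (.bin .add (.bin .mul (.bin .sub (.bin .div (.get 9 (.reg 4)) (.reg 1))
            (.bin .mul (.reg 2) (.bin .sub (.reg 0) (.bin .sub (.reg 4) (.reg 3))))) (.reg 1))
            (.bin .mod (.get 9 (.reg 4)) (.reg 1))))))

/-- For each length, compute the best prefix of an explicit node (array `10`). -/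
def computeMaxima : Prog :=
  .upTo 2 (.bin .add (.reg 0) (.lit 1))
    (.seq (.set 3 (.bin .add (.bin .div (.reg 0) (.reg 2)) (.lit 1)))
    (.seq (.set 4 (.lit 0))
    (.seq clearTree
    (.seq insertEdges
    (.seq (.set 4 (.lit 1)) pushDown)))))

/-- Read off the shortest partial covers from the maxima (arrays `5` and `6`). -/
def writeOutput : Prog :=
  .upTo 2 (.bin .add (.reg 0) (.lit 1))
    (.while (.bin .lt (.reg 3) (.bin .add (.bin .div (.get 10 (.reg 2)) (.reg 1)) (.lit 1)))
      (.seq (.put 5 (.reg 3) (.bin .mod (.get 10 (.reg 2)) (.reg 1)))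
      (.seq (.put 6 (.reg 3)
        (.bin .sub (.get 1 (.bin .mod (.get 10 (.reg 2)) (.reg 1))) (.reg 2)))
        (.set 3 (.bin .add (.reg 3) (.lit 1))))))

/-- The algorithm computing the loci of all shortest partial covers. -/
def partialCovers : Prog :=
  .seq buildLists (.seq (.set 2 (.lit 1)) (.seq computeMaxima
    (.seq (.set 2 (.lit 1)) (.seq (.set 3 (.lit 1)) writeOutput))))

end Program

/-! ### The segment tree -/

section SegmentTree

variable {S W B N : ℕ} {σ : State}

theorem ends_clearTree (hN : 2 * N ≤ S) (hW : 2 * N + 2 < W) (h3 : σ.reg 3 = N)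
    (h4 : σ.reg 4 = 0) :
    Ends S W clearTree σ (26 * N + 6) fun τ => ∃ T, τ.mem = Function.update σ.mem 9 T ∧
      (∀ r, r ≠ 4 → τ.reg r = σ.reg r) ∧ ∀ q < 2 * N, T q = 0 := by
  refine (Ends.upTo (a := 0) (b := 2 * N) (fun i τ => i ≤ 2 * N ∧ τ.reg 4 = i ∧ ∃ T,
    τ.mem = Function.update σ.mem 9 T ∧
      (∀ r, r ≠ 4 → τ.reg r = σ.reg r) ∧ ∀ q < i, T q = 0) (fun _ => 3) (by omega) ?_ ?_
      ⟨by omega, h4, σ.mem 9, by simp, by simp, by simp⟩).mono ?_ fun τ h => h.2.2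
  · rintro i τ ⟨h1, h2, T, -, hr, -⟩
    have := hr 3 (by norm_num)
    simp only [Expr.Fits, Expr.val, Op.apply, this, h3]
    omega
  · rintro i τ ⟨h1, h2, T, hm, hr, hT⟩ hi
    refine Ends.put (by simp only [Expr.Fits]; omega) (by simp only [Expr.Fits]; omega)
      (by simp only [Expr.val]; omega) (by decide) ?_
    refine ⟨by simpa using h2, by omega, by simp, Function.update T i 0, ?_, ?_, ?_⟩
    · funext a
      simp only [State.setReg_mem, State.setMem_mem, hm, Expr.val, h2, Function.update_apply]
      split_ifs <;> simp
    · intro r hr'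
      simp [hr', hr r hr']
    · intro q hq
      by_cases h : q = i
      · simp [h]
      · rw [Function.update_of_ne h]
        exact hT q (by omega)
  · simp [Expr.cost]; omega

/-- Both ends of the range are marked at every level, without a parity test: all leaves below a node
of the range lie in the interval, so this is harmless. An unmarked node of the range has its parent
in the next range. `N` need not be a power of two. A level costs 4 for the test and 34 for the body.
-/
theorem ends_markInterval {l₀ r₀ x : ℕ} {T₀ : ℕ → ℕ} (hN : 2 * N ≤ S) (hW : 2 * N + 2 < W)
    (hBW : B < W) (hN0 : 0 < N) (h6 : σ.reg 6 = l₀) (h7 : σ.reg 7 = r₀) (h8 : σ.reg 8 = x)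
    (h9 : σ.mem 9 = T₀) (hl : N ≤ l₀) (hr : r₀ ≤ 2 * N) (hl' : l₀ ≤ 2 * N) (hx : x ≤ B)
    (hT₀ : ∀ q < 2 * N, T₀ q ≤ B) :
    Ends S W markInterval σ (38 * Nat.log 2 r₀ + 4) fun τ => ∃ T, τ.mem = Function.update σ.mem 9 T ∧
      (∀ r, r ≠ 6 → r ≠ 7 → τ.reg r = σ.reg r) ∧ (∀ q, T₀ q ≤ T q) ∧
      (∀ q, T q = T₀ q ∨ T q = x ∧
        ∀ p k, N ≤ p → p < 2 * N → p / 2 ^ k = q → l₀ ≤ p ∧ p < r₀) ∧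
      ∀ p, l₀ ≤ p → p < r₀ → ∃ k, x ≤ T (p / 2 ^ k) := by
  refine (Ends.while (γ := ℕ × ℕ × (ℕ → ℕ)) (fun g τ => τ.reg 6 = g.1 ∧ τ.reg 7 = g.2.1 ∧
    τ.mem = Function.update σ.mem 9 g.2.2 ∧ (∀ r, r ≠ 6 → r ≠ 7 → τ.reg r = σ.reg r) ∧
    0 < g.1 ∧ g.1 ≤ 2 * N ∧ g.2.1 ≤ 2 * N ∧
    (∀ q, g.1 ≤ q → q < g.2.1 →
      ∀ p k, N ≤ p → p < 2 * N → p / 2 ^ k = q → l₀ ≤ p ∧ p < r₀) ∧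
    (∀ q, T₀ q ≤ g.2.2 q) ∧
    (∀ q, g.2.2 q = T₀ q ∨ g.2.2 q = x ∧
        ∀ p k, N ≤ p → p < 2 * N → p / 2 ^ k = q → l₀ ≤ p ∧ p < r₀) ∧
    ∀ p, l₀ ≤ p → p < r₀ → (∃ k, x ≤ g.2.2 (p / 2 ^ k)) ∨
      ∃ k, g.1 ≤ p / 2 ^ k ∧ p / 2 ^ k < g.2.1) (fun g => 38 * Nat.log 2 g.2.1 + 4)
    ?_ ?_ ?_ (g := (l₀, r₀, T₀)) ?_).mono le_rfl ?_
  · rintro ⟨l, r, T⟩ τ ⟨e6, e7, -, -, hl0, hl2, hr2, -⟩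
    simp only at e6 e7 hl0 hl2 hr2
    simp only [Expr.Fits, Op.apply, e6, e7]
    refine ⟨by omega, by omega, ?_⟩
    split_ifs <;> omega
  · rintro ⟨l, r, T⟩ τ -
    simp [Expr.cost]
  · rintro ⟨l, r, T⟩ τ ⟨e6, e7, hm, hreg, hl0, hl2, hr2, hin, hmono, hsound, hcompl⟩ h0
    simp only at e6 e7 hm hl0 hl2 hr2 hin hmono hsound hcompl
    have hlr : l < r := by
      by_contra hc
      simp [Expr.val, Op.apply, e6, e7, hc] at h0
    have e8 : τ.reg 8 = x := by rw [hreg 8 (by norm_num) (by norm_num), h8]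
    have hTB : ∀ q < 2 * N, T q ≤ B := by
      intro q hq
      rcases hsound q with h | h
      · rw [h]; exact hT₀ q hq
      · rw [h.1]; exact hx
    have hTl := hTB l (by omega)
    set T1 := Function.update T l (max (T l) x) with hT1
    have hT1r : T1 (r - 1) ≤ B := by
      rw [hT1, Function.update_apply]
      split_ifs
      · exact max_le hTl hx
      · exact hTB _ (by omega)
    set T2 := Function.update T1 (r - 1) (max (T1 (r - 1)) x) with hT2
    have hT2v : ∀ q, T2 q = if q = l ∨ q = r - 1 then max (T q) x else T q := by
      intro q
      simp only [hT2, hT1, Function.update_apply]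
      by_cases h1 : q = r - 1 <;> by_cases h2 : q = l
      · subst h2; simp [← h1]
      · subst h1; simp [h2]
      · subst h2; simp [h1]
      · simp [h1, h2]
    refine ⟨34, ?_⟩
    refine Ends.put_seq (by simp only [Expr.Fits]; omega) (Expr.fits_max ?_ ?_ ?_ ?_)
      (by simp only [Expr.val]; omega) (by decide) ?_
    · simp only [Expr.Fits, Expr.val, e6, hm, Function.update_self]; omega
    · simp only [Expr.Fits]; omega
    · simp only [Expr.val, e6, hm, Function.update_self]; omega
    · simp only [Expr.val]; omega
    have hmem1 : (τ.setMem 9 l (max (T l) x)).mem = Function.update σ.mem 9 T1 := by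
      funext a
      simp only [State.setMem_mem, hm, Function.update_apply, hT1]
      split_ifs <;> simp
    rw [Expr.val_max]
    simp only [Expr.val, e6, e8, hm, Function.update_self]
    set τ1 := τ.setMem 9 l (max (T l) x) with hτ1
    have e6' : τ1.reg 6 = l := e6
    have e7' : τ1.reg 7 = r := e7
    have e8' : τ1.reg 8 = x := e8
    refine Ends.put_seq ?_ (Expr.fits_max ?_ ?_ ?_ ?_) ?_ (by decide) ?_
    · simp only [Expr.Fits, Expr.val, Op.apply, e7']; omega
    · simp only [Expr.Fits, Expr.val, Op.apply, e7', hmem1, Function.update_self]; omega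
    · simp only [Expr.Fits, e8']; omega
    · simp only [Expr.val, Op.apply, e7', hmem1, Function.update_self]; omega
    · simp only [Expr.val, e8']; omega
    · simp only [Expr.val, Op.apply, e7']; omega
    rw [Expr.val_max]
    simp only [Expr.val, Op.apply, e7', e8', hmem1, Function.update_self]
    have hmem2 : (τ1.setMem 9 (r - 1) (max (T1 (r - 1)) x)).mem = Function.update σ.mem 9 T2 := by
      funext a
      simp only [State.setMem_mem, hmem1, Function.update_apply, hT2]
      split_ifs <;> simp
    set τ2 := τ1.setMem 9 (r - 1) (max (T1 (r - 1)) x) with hτ2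
    have hreg2 : τ2.reg = τ.reg := rfl
    refine Ends.set_seq ?_ (by decide) (Ends.set ?_ (by decide) ?_)
    · simp only [Expr.Fits, Expr.val, Op.apply, hreg2, e6]; omega
    · simp only [Expr.Fits, Expr.val, Op.apply, State.setReg_reg, hreg2, e7]; norm_num; omega
    refine ⟨((l + 1) / 2, r / 2, T2), ⟨?_, ?_, ?_, ?_, ?_, ?_, ?_, ?_, ?_, ?_, ?_⟩, ?_⟩
    · simp [Expr.val, Op.apply, hreg2, e6]
    · simp [Expr.val, Op.apply, hreg2, e7]
    · exact hmem2
    · intro r' h1 h2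
      simp [h1, h2, hreg2, hreg r' h1 h2]
    · simp only; omega
    · simp only; omega
    · simp only; omega
    · simp only
      intro q h1 h2 p k hp hp2 hpk
      -- A leaf is impossible because r / 2 ≤ N. Otherwise p / 2 ^ k is 2q or 2q + 1, and both lie
      -- in [l, r).
      cases k with
      | zero => simp at hpk; omega
      | succ k =>
        rw [pow_succ, ← Nat.div_div_eq_div_mul] at hpk
        exact hin (p / 2 ^ k) (by omega) (by omega) p k hp hp2 rfl
    · intro q
      simp only [hT2v]
      split_ifs
      · exact (hmono q).trans (le_max_left _ _)
      · exact hmono q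
    · intro q
      simp only [hT2v]
      split_ifs with h
      · rcases le_total (T q) x with h' | h'
        · rw [max_eq_right h']
          exact Or.inr ⟨rfl, hin q (by omega) (by omega)⟩
        · rw [max_eq_left h']
          exact hsound q
      · exact hsound q
    · intro p hp1 hp2
      rcases hcompl p hp1 hp2 with ⟨k, hk⟩ | ⟨k, hk1, hk2⟩
      · left
        refine ⟨k, ?_⟩
        simp only [hT2v]
        split_ifs
        · exact le_max_right _ _
        · exact hk
      · by_cases h : p / 2 ^ k = l ∨ p / 2 ^ k = r - 1
        · left
          refine ⟨k, ?_⟩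
          simp only [hT2v, if_pos h]
          exact le_max_right _ _
        · right
          refine ⟨k + 1, ?_⟩
          rw [pow_succ, ← Nat.div_div_eq_div_mul]
          simp only
          omega
    · simp only [Nat.log_div_base, Expr.cost]
      -- From 0 < l < r follows r ≥ 2, so halving r lowers its logarithm by one.
      have : 0 < Nat.log 2 r := Nat.log_pos one_lt_two (by omega)
      omega
  · refine ⟨h6, h7, by simp [← h9], fun _ _ _ => rfl, by simp only; omega, hl', hr, ?_,
      fun _ => le_rfl, fun _ => Or.inl rfl, fun p h1 h2 => Or.inr ⟨0, by simpa using ⟨h1, h2⟩⟩⟩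
    simp only
    intro q h1 h2 p k hp hp2 hpk
    cases k with
    | zero => simp at hpk; omega
    | succ k =>
      have : p / 2 ^ (k + 1) < N := by
        rw [Nat.div_lt_iff_lt_mul (by positivity), pow_succ]
        have := Nat.one_le_two_pow (n := k)
        nlinarith
      omega
  · rintro τ ⟨⟨l, r, T⟩, ⟨e6, e7, hm, hreg, -, -, -, -, hmono, hsound, hcompl⟩, h0⟩
    simp only at e6 e7 hm hmono hsound hcompl
    have hlr : ¬ l < r := by
      intro hc
      simp [Expr.val, Op.apply, e6, e7, hc] at h0
    refine ⟨T, hm, hreg, hmono, hsound, fun p h1 h2 => ?_⟩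
    rcases hcompl p h1 h2 with h | ⟨k, hk1, hk2⟩
    · exact h
    · omega

/-- The node q / 2 is treated before q, so each cell becomes the maximum over its path to the root.
Cell 0 of the maxima is junk, since i - N is truncated and every inner node writes there; hence the
condition 0 < l. -/
theorem ends_pushDown {s n m : ℕ} {T₀ M₀ : ℕ → ℕ} (hN : 2 * N ≤ S) (hW : 2 * N + 2 < W)
    (hBW : B < W) (hN0 : 0 < N) (hNn : N ≤ n + 1) (hs : s * n < W) (h0 : σ.reg 0 = n)
    (h1 : σ.reg 1 = m) (h2 : σ.reg 2 = s) (h3 : σ.reg 3 = N) (h4 : σ.reg 4 = 1)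
    (hn : n < W) (hm : m < W) (hsW : s < W)
    (h9 : σ.mem 9 = T₀) (h10 : σ.mem 10 = M₀) (hT₀ : ∀ q < 2 * N, T₀ q ≤ B) (hM₀ : ∀ l, M₀ l ≤ B) :
    Ends S W pushDown σ (140 * N) fun τ => ∃ T M,
      τ.mem = Function.update (Function.update σ.mem 9 T) 10 M ∧
      (∀ r, r ≠ 4 → τ.reg r = σ.reg r) ∧ (∀ l, M l ≤ B) ∧
      (∀ q < 2 * N, (∀ k, T₀ (q / 2 ^ k) ≤ T q) ∧ ∃ k, T q = T₀ (q / 2 ^ k)) ∧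
      ∀ l, 0 < l → M l = if N + l < 2 * N then max (M₀ l)
        ((T (N + l) / m - s * (n - l)) * m + T (N + l) % m) else M₀ l := by
  -- Decoding never increases a number, truncated or not, so B keeps bounding the maxima.
  have hdec : ∀ t x, (t / m - x) * m + t % m ≤ t := fun t x =>
    (Nat.add_le_add_right (Nat.mul_le_mul_right m (Nat.sub_le _ _)) _).trans (Nat.div_add_mod' t m).le
  refine (Ends.upTo (a := 1) (b := 2 * N) (fun i τ => i ≤ 2 * N ∧ 0 < i ∧ τ.reg 4 = i ∧ ∃ T M,
      τ.mem = Function.update (Function.update σ.mem 9 T) 10 M ∧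
      (∀ r, r ≠ 4 → τ.reg r = σ.reg r) ∧ (∀ l, M l ≤ B) ∧
      (∀ q < i, (∀ k, T₀ (q / 2 ^ k) ≤ T q) ∧ ∃ k, T q = T₀ (q / 2 ^ k)) ∧
      (∀ q, i ≤ q → T q = T₀ q) ∧
      ∀ l, 0 < l → M l = if N + l < i then max (M₀ l)
        ((T (N + l) / m - s * (n - l)) * m + T (N + l) % m) else M₀ l) (fun _ => 60)
      (by omega) ?_ ?_ ⟨by omega, one_pos, h4, T₀, M₀, ?_, ?_, hM₀, ?_, ?_, ?_⟩).mono ?_ ?_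
  · rintro i τ ⟨hi, -, e4, T, M, -, hreg, -⟩
    have e3 := hreg 3 (by norm_num)
    simp only [Expr.Fits, Expr.val, Op.apply, e3, h3]
    omega
  · rintro i τ ⟨-, hi0, e4, T, M, hmem, hreg, hM, hlow, hhigh, hMl⟩ hi
    have e0 : τ.reg 0 = n := by rw [hreg 0 (by norm_num), h0]
    have e1 : τ.reg 1 = m := by rw [hreg 1 (by norm_num), h1]
    have e2 : τ.reg 2 = s := by rw [hreg 2 (by norm_num), h2]
    have e3 : τ.reg 3 = N := by rw [hreg 3 (by norm_num), h3]
    have m9 : τ.mem 9 = T := by simp [hmem]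
    have m10 : τ.mem 10 = M := by simp [hmem]
    have hTi : T i ≤ B := by rw [hhigh i le_rfl]; exact hT₀ i hi
    have hTi2 : T (i / 2) ≤ B := by
      obtain ⟨k, hk⟩ := (hlow (i / 2) (by omega)).2
      rw [hk]
      exact hT₀ _ (lt_of_le_of_lt (Nat.div_le_self _ _) (by omega))
    refine Ends.put_seq (by simp only [Expr.Fits]; omega) (Expr.fits_max ?_ ?_ ?_ ?_)
      (by simp only [Expr.val]; omega) (by decide) ?_
    · simp only [Expr.Fits, Expr.val, e4, m9]; omega
    · simp only [Expr.Fits, Expr.val, Op.apply, e4, m9]; omega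
    · simp only [Expr.val, e4, m9]; omega
    · simp only [Expr.val, Op.apply, e4, m9]; omega
    rw [Expr.val_max]
    simp only [Expr.val, Op.apply, e4, m9]
    set y := max (T i) (T (i / 2)) with hy
    have hyB : y ≤ B := max_le hTi hTi2
    set T1 := Function.update T i y with hT1
    set τ1 := τ.setMem 9 i y with hτ1
    have m9' : τ1.mem 9 = T1 := by simp [hτ1, hT1, m9]
    have m10' : τ1.mem 10 = M := by simp [hτ1, m10]
    have hT1i : T1 i = y := by simp [hT1]
    have hreg1 : τ1.reg = τ.reg := rfl
    have hym : y / m ≤ y := Nat.div_le_self _ _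
    have hsn : s * (n - (i - N)) ≤ s * n := Nat.mul_le_mul_left _ (Nat.sub_le _ _)
    have hmod : y % m ≤ y := Nat.mod_le _ _
    have hd := hdec y (s * (n - (i - N)))
    have hMi := hM (i - N)
    refine Ends.put ?_ (Expr.fits_max ?_ ?_ ?_ ?_) ?_ (by decide) ?_
    · simp only [Expr.Fits, Expr.val, Op.apply, hreg1, e3, e4]; omega
    · simp only [Expr.Fits, Expr.val, Op.apply, hreg1, e3, e4, m10']; omega
    · simp only [Expr.Fits, Expr.val, Op.apply, hreg1, e0, e1, e2, e3, e4, m9', hT1i]; omega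
    · simp only [Expr.val, Op.apply, hreg1, e3, e4, m10']; omega
    · simp only [Expr.val, Op.apply, hreg1, e0, e1, e2, e3, e4, m9', hT1i]; omega
    · simp only [Expr.val, Op.apply, hreg1, e3, e4]; omega
    rw [Expr.val_max]
    simp only [Expr.val, Op.apply, hreg1, e0, e1, e2, e3, e4, m9', m10', hT1i]
    set z := max (M (i - N)) ((y / m - s * (n - (i - N))) * m + y % m) with hz
    refine ⟨by simp [hreg1, e4], by omega, by omega, by simp, T1, Function.update M (i - N) z,
      ?_, ?_, ?_, ?_, ?_, ?_⟩
    · funext a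
      by_cases ha : a = 10
      · subst ha; simp [m10']
      · by_cases hb : a = 9
        · subst hb; simp [m9']
        · simp [ha, hb, hτ1, hmem]
    · intro r hr
      simp [hr, hreg1, hreg r hr]
    · intro l
      rw [Function.update_apply]
      split_ifs
      · exact max_le hMi (hd.trans hyB)
      · exact hM l
    · intro q hq
      rcases Nat.lt_succ_iff_lt_or_eq.1 hq with h | rfl
      · rw [hT1, Function.update_of_ne h.ne]
        exact hlow q h
      · rw [hT1i]
        have hq2 := hlow (q / 2) (by omega)
        constructor
        · intro k
          cases k with
          | zero => simp [hy, hhigh q le_rfl]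
          | succ k =>
            rw [pow_succ', ← Nat.div_div_eq_div_mul]
            exact (hq2.1 k).trans (le_max_right _ _)
        · rcases max_choice (T q) (T (q / 2)) with h | h
          · exact ⟨0, by rw [hy, h, hhigh q le_rfl]; simp⟩
          · obtain ⟨k, hk⟩ := hq2.2
            exact ⟨k + 1, by rw [hy, h, hk, pow_succ', ← Nat.div_div_eq_div_mul]⟩
    · intro q hq
      rw [hT1, Function.update_of_ne (by omega)]
      exact hhigh q (by omega)
    · intro l hl
      have hl' := hMl l hl
      rcases lt_trichotomy (N + l) i with h | h | h
      · rw [Function.update_of_ne (by omega), hl', if_pos h, if_pos (by omega), hT1,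
          Function.update_of_ne h.ne]
      · have : i - N = l := by omega
        rw [if_pos (by omega), this, Function.update_self, h, hT1i, hz, this, hl',
          if_neg (by omega)]
      · rw [Function.update_of_ne (by omega), hl', if_neg (by omega), if_neg (by omega)]
  · funext a
    simp only [Function.update_apply]
    split_ifs with h h' <;> simp_all
  · simp
  · intro q hq
    have : q = 0 := by omega
    subst this
    exact ⟨fun k => by simp, 0, by simp⟩
  · simp
  · intro l hl
    rw [if_neg (by omega)]
  · simp [Expr.cost]; omega
  · rintro τ ⟨-, -, -, T, M, hmem, hreg, hM, hlow, -, hMl⟩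
    exact ⟨T, M, hmem, hreg, hM, hlow, hMl⟩

end SegmentTree

/-! ### Edges with linear weights -/

section EdgeData

/-- Parents, depths, cover indices and slopes of the nodes `0, …, m - 1` of a tree of depth `n`. -/
structure EdgeData where
  n : ℕ
  m : ℕ
  par : ℕ → ℕ
  dep : ℕ → ℕ
  cov : ℕ → ℕ
  del : ℕ → ℕ
  m_pos : 0 < m
  par_lt : ∀ v < m, par v < m
  dep_le : ∀ v < m, dep v ≤ n
  dep_par_le : ∀ v < m, dep (par v) ≤ dep v
  cov_le : ∀ v < m, cov v ≤ n
  del_le : ∀ v < m, del v ≤ n + 1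
  del_pos : ∀ v < m, 0 < del v
  del_mul_dep_le : ∀ v < m, del v * dep v ≤ n
  le_cov : ∀ v < m, ∀ l, dep (par v) < l → l ≤ dep v → del v * (dep v - l) ≤ cov v
  exists_full : 0 < n → ∃ v < m, dep (par v) < n ∧ dep v = n ∧ cov v = n

namespace EdgeData

variable (E : EdgeData)

/-- The length `l` occurs on the edge from the node `v` to its parent. -/
def Edge (v l : ℕ) : Prop := v < E.m ∧ E.dep (E.par v) < l ∧ l ≤ E.dep v

/-- The cover index at the length `l` on the edge of `v`. -/
def covAt (v l : ℕ) : ℕ := E.cov v - E.del v * (E.dep v - l)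

/-- The linear function of the edge of `v`, extended to the length `n`, together with `v`. -/
def key (v : ℕ) : ℕ := (E.cov v + E.del v * (E.n - E.dep v)) * E.m + v

/-- The cover index at the length `l` on the edge of `v`, together with `v`. -/
def code (v l : ℕ) : ℕ := E.covAt v l * E.m + v

/-- A bound for the keys. -/
def bound : ℕ := (E.n * E.n + E.n + 1) * E.m

/-- The registers and arrays of the input. -/
def Loaded (σ : State) : Prop :=
  σ.reg 0 = E.n ∧ σ.reg 1 = E.m ∧ σ.mem 0 = E.par ∧ σ.mem 1 = E.dep ∧ σ.mem 3 = E.cov ∧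
    σ.mem 4 = E.del

variable {E} {S W s N v l : ℕ} {σ : State}

theorem weight_le (hv : v < E.m) (h : E.del v ≤ E.n) :
    E.cov v + E.del v * (E.n - E.dep v) ≤ E.n * E.n + E.n := by
  have h1 := E.cov_le v hv
  have h2 : E.del v * (E.n - E.dep v) ≤ E.n * E.n := Nat.mul_le_mul h (Nat.sub_le _ _)
  omega

theorem key_lt (hv : v < E.m) (h : E.del v ≤ E.n) : E.key v < E.bound := by
  have := Nat.mul_le_mul_right E.m (weight_le hv h)
  simp only [key, bound, Nat.succ_mul]
  omega

theorem le_bound : E.n * E.n + E.n + 1 ≤ E.bound := Nat.le_mul_of_pos_right _ E.m_pos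

theorem key_div (hv : v < E.m) : E.key v / E.m = E.cov v + E.del v * (E.n - E.dep v) := by
  rw [key, mul_comm, Nat.mul_add_div E.m_pos, Nat.div_eq_of_lt hv, add_zero]

theorem key_mod (hv : v < E.m) : E.key v % E.m = v := by
  rw [key, mul_comm, Nat.mul_add_mod, Nat.mod_eq_of_lt hv]

theorem code_div (hv : v < E.m) : E.code v l / E.m = E.covAt v l := by
  rw [code, mul_comm, Nat.mul_add_div E.m_pos, Nat.div_eq_of_lt hv, add_zero]

theorem code_mod (hv : v < E.m) : E.code v l % E.m = v := by
  rw [code, mul_comm, Nat.mul_add_mod, Nat.mod_eq_of_lt hv]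

/-- This moves along the line of the edge from length n back to length l. -/
theorem key_to_code (h : E.Edge v l) :
    (E.key v / E.m - E.del v * (E.n - l)) * E.m + E.key v % E.m = E.code v l := by
  obtain ⟨hv, h1, h2⟩ := h
  rw [key_div hv, key_mod hv, code, covAt]
  have h3 := E.dep_le v hv
  have h4 : E.del v * (E.n - l) = E.del v * (E.dep v - l) + E.del v * (E.n - E.dep v) := by
    rw [← mul_add]; congr 1; omega
  rw [h4, Nat.add_sub_add_right]

/-! ### Inserting the edges of one slope into the segment tree -/

theorem ends_loadEdge (hm : E.m ≤ S) (hW : E.bound + 4 * E.n + 2 * E.m + 20 < W)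
    (hσ : E.Loaded σ) (h2 : σ.reg 2 = s) (h3 : σ.reg 3 = N) (h5 : σ.reg 5 = v + 1)
    (hv : v < E.m) (hs : E.del v = s) (hsn : s ≤ E.n) (hN : N ≤ E.n + 1) :
    Ends S W loadEdge σ 33 fun τ => τ.mem = σ.mem ∧
      (∀ r, r ≠ 5 → r ≠ 6 → r ≠ 7 → r ≠ 8 → τ.reg r = σ.reg r) ∧ τ.reg 5 = v ∧
      τ.reg 6 = E.dep (E.par v) + 1 + N ∧ τ.reg 7 = E.dep v + 1 + N ∧ τ.reg 8 = E.key v := by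
  obtain ⟨e0, e1, m0, m1, m3, m4⟩ := hσ
  have b0 := E.par_lt v hv
  have b1 := E.dep_le _ b0
  have b2 := E.dep_le v hv
  have b3 := E.cov_le v hv
  have b4 := key_lt hv (hs.trans_le hsn)
  have b5 := weight_le hv (hs.trans_le hsn)
  have b6 := E.le_bound
  rw [key] at b4
  rw [hs] at b4 b5
  refine Ends.set_seq ?_ (by decide) ?_
  · simp only [Expr.Fits, Expr.val, Op.apply, h5]; omega
  refine Ends.set_seq ?_ (by decide) ?_
  · simp [Expr.Fits, Expr.val, Op.apply, h5, h3, m0, m1]; omega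
  refine Ends.set_seq ?_ (by decide) ?_
  · simp [Expr.Fits, Expr.val, Op.apply, h5, h3, m0, m1]; omega
  refine Ends.set ?_ (by decide) ?_
  · simp [Expr.Fits, Expr.val, Op.apply, h5, h3, h2, e0, e1, m0, m1, m3]; omega
  refine ⟨rfl, fun r h5 h6 h7 h8 => by simp [h5, h6, h7, h8], ?_, ?_, ?_, ?_⟩ <;>
    simp [Expr.val, Op.apply, h5, h3, h2, e0, e1, m0, m1, m3, key, hs]

/-- The linked list `nx` from the pointer `e` (`0` for the end, `v + 1` for `v`) is `L`. -/
def Chain (nx : ℕ → ℕ) : ℕ → List ℕ → Prop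
  | e, [] => e = 0
  | e, v :: L => e = v + 1 ∧ Chain nx (nx v) L

theorem Chain.le {nx : ℕ → ℕ} {m e : ℕ} : ∀ {L : List ℕ}, Chain nx e L → (∀ v ∈ L, v < m) → e ≤ m
  | [], h, _ => by rw [Chain] at h; omega
  | v :: L, h, hL => by
    have := hL v (by simp)
    have := h.1
    omega

/-- Nodes are linked in increasing order, so the cell of a new node belongs to no earlier list. -/
theorem Chain.update {nx : ℕ → ℕ} {m x : ℕ} : ∀ {L : List ℕ} {e : ℕ}, Chain nx e L →
    (∀ v ∈ L, v < m) → Chain (Function.update nx m x) e L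
  | [], _, h, _ => h
  | v :: L, _, h, hL => by
    refine ⟨h.1, ?_⟩
    rw [Function.update_of_ne (hL v (by simp)).ne]
    exact h.2.update fun v hv => hL v (by simp [hv])

/-- Every nonzero value in the segment tree `T` is the key of an edge that covers its leaves. -/
def TreeSound (E : EdgeData) (L : List ℕ) (N : ℕ) (T : ℕ → ℕ) : Prop :=
  ∀ q < 2 * N, T q = 0 ∨ ∃ v ∈ L, T q = E.key v ∧
    ∀ p k, N ≤ p → p < 2 * N → p / 2 ^ k = q → E.dep (E.par v) + 1 + N ≤ p ∧ p < E.dep v + 1 + N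

/-- The key of `v` is at most some value above each leaf of the edge of `v`. -/
def TreeCovers (E : EdgeData) (v N : ℕ) (T : ℕ → ℕ) : Prop :=
  ∀ p, E.dep (E.par v) + 1 + N ≤ p → p < E.dep v + 1 + N → ∃ k, E.key v ≤ T (p / 2 ^ k)

/-- An edge costs 2 for the test, 33 for loading, 38 (log n + 2) + 4 for marking and 3 for following
the list. -/
theorem ends_insertEdges {hd nx : ℕ → ℕ} {L : List ℕ} (hS : 2 * E.n + 2 ≤ S) (hm : E.m ≤ S)
    (hW : E.bound + 4 * E.n + 2 * E.m + 20 < W)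
    (hσ : E.Loaded σ) (h2 : σ.reg 2 = s) (h3 : σ.reg 3 = N) (h7 : σ.mem 7 = hd) (h8 : σ.mem 8 = nx)
    (hs : 0 < s) (hsn : s ≤ E.n) (hN : N = E.n / s + 1) (hL : ∀ v ∈ L, v < E.m ∧ E.del v = s)
    (hc : Chain nx (hd s) L) (h9 : ∀ q < 2 * N, σ.mem 9 q = 0) :
    Ends S W insertEdges σ (L.length * (38 * Nat.log 2 E.n + 118) + 5) fun τ => ∃ T,
      τ.mem = Function.update σ.mem 9 T ∧
      (∀ r, r ≠ 5 → r ≠ 6 → r ≠ 7 → r ≠ 8 → τ.reg r = σ.reg r) ∧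
      E.TreeSound L N T ∧ ∀ v ∈ L, E.TreeCovers v N T := by
  have hNn : N ≤ E.n + 1 := by
    rw [hN]
    exact Nat.add_le_add_right (Nat.div_le_self _ _) 1
  have hB := E.le_bound
  have hhd : hd s ≤ E.m := hc.le fun v hv => (hL v hv).1
  refine Ends.seq (T₁ := 3) (T₂ := L.length * (38 * Nat.log 2 E.n + 118) + 2)
    (Ends.set ?_ (by decide) ?_) (by omega)
  · simp only [Expr.Fits, Expr.val, h2, h7]; omega
  simp only [Expr.val, h2, h7]
  refine (Ends.while (γ := List ℕ × (ℕ → ℕ)) (fun g τ => Chain nx (τ.reg 5) g.1 ∧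
    τ.mem = Function.update σ.mem 9 g.2 ∧
    (∀ r, r ≠ 5 → r ≠ 6 → r ≠ 7 → r ≠ 8 → τ.reg r = σ.reg r) ∧ (∀ v ∈ g.1, v ∈ L) ∧
      E.TreeSound L N g.2 ∧ ∀ v ∈ L, v ∈ g.1 ∨ E.TreeCovers v N g.2)
    (fun g => g.1.length * (38 * Nat.log 2 E.n + 118) + 2) ?_ ?_ ?_ (g := (L, σ.mem 9)) ?_).mono
    le_rfl ?_
  · rintro ⟨L', T⟩ τ ⟨hc', -, -, hL', -⟩
    have := hc'.le fun v hv => (hL v (hL' v hv)).1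
    simp only [Expr.Fits]; omega
  · rintro ⟨L', T⟩ τ -
    simp [Expr.cost]
  · rintro ⟨L', T⟩ τ ⟨hc', hmem, hreg, hL', hsound, hcov⟩ h0
    simp only at hc' hmem hL' hsound hcov
    cases L' with
    | nil => exact absurd hc' h0
    | cons v L' =>
    obtain ⟨h5, hc'⟩ := hc'
    obtain ⟨hv, hvs⟩ := hL v (hL' v (by simp))
    have hτ : E.Loaded τ := by
      obtain ⟨e0, e1, m0, m1, m3, m4⟩ := hσ
      refine ⟨?_, ?_, ?_, ?_, ?_, ?_⟩ <;> simp [*]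
    -- By Δ(v)|v| ≤ n, the last leaf N + |v| of the edge lies in the tree.
    have hdepN : E.dep v + 1 ≤ N := by
      rw [hN, Nat.add_le_add_iff_right, Nat.le_div_iff_mul_le hs, mul_comm, ← hvs]
      exact E.del_mul_dep_le v hv
    have hpar := E.dep_par_le v hv
    have hkey := key_lt hv (hvs.trans_le hsn)
    refine ⟨33 + (38 * (Nat.log 2 E.n + 2) + 4 + 3), Ends.seq ((ends_loadEdge hm hW hτ
      (by rw [hreg 2 (by norm_num) (by norm_num) (by norm_num) (by norm_num), h2])
      (by rw [hreg 3 (by norm_num) (by norm_num) (by norm_num) (by norm_num), h3]) h5 hv hvs hsn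
      hNn).mono le_rfl ?_) le_rfl⟩
    rintro τ1 ⟨hmem1, hreg1, e5, e6, e7, e8⟩
    refine Ends.seq ((ends_markInterval (N := N) (B := E.bound) (T₀ := T) (by omega) (by omega)
      (by omega) (by omega) e6 e7 e8 (by simp [hmem1, hmem]) (by omega) (by omega) (by omega) hkey.le
      ?_).mono (Nat.add_le_add_right (Nat.mul_le_mul_left 38 ?_) 4) ?_) le_rfl
    · intro q hq
      rcases hsound q hq with h | ⟨v', hv', h, -⟩
      · omega
      · rw [h]
        exact (key_lt (hL v' hv').1 ((hL v' hv').2.trans_le hsn)).le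
    -- The right end is at most 2N ≤ 2n + 2 ≤ 4n, as n ≥ s ≥ 1.
    · calc Nat.log 2 (E.dep v + 1 + N) ≤ Nat.log 2 (E.n * 2 * 2) := Nat.log_mono_right (by omega)
        _ = Nat.log 2 E.n + 2 := by
          rw [Nat.log_mul_base one_lt_two (by omega), Nat.log_mul_base one_lt_two (by omega)]
    rintro τ2 ⟨T2, hmem2, hreg2, hmono, hsound2, hcov2⟩
    have f5 : τ2.reg 5 = v := by rw [hreg2 5 (by norm_num) (by norm_num), e5]
    have m8 : τ2.mem 8 = nx := by simp [hmem2, hmem1, hmem, h8]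
    have hnx : nx v ≤ E.m := hc'.le fun v hv => (hL v (hL' v (by simp [hv]))).1
    refine Ends.set ?_ (by decide) ⟨(L', T2), ⟨?_, ?_, ?_, ?_, ?_, ?_⟩, ?_⟩
    · simp only [Expr.Fits, Expr.val, f5, m8]; omega
    · simpa [Expr.val, f5, m8] using hc'
    · simp [hmem2, hmem1, hmem]
    · intro r h5 h6 h7 h8
      simp [h5, hreg2 r h6 h7, hreg1 r h5 h6 h7 h8, hreg r h5 h6 h7 h8]
    · exact fun v hv => hL' v (by simp [hv])
    · intro q hq
      rcases hsound2 q with h | h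
      · simp only [h]
        exact hsound q hq
      · exact Or.inr ⟨v, hL' v (by simp), h⟩
    · intro v' hv'
      rcases hcov v' hv' with h | h
      · rcases List.mem_cons.1 h with rfl | h
        · exact Or.inr hcov2
        · exact Or.inl h
      · refine Or.inr fun p hp1 hp2 => ?_
        obtain ⟨k, hk⟩ := h p hp1 hp2
        exact ⟨k, hk.trans (hmono _)⟩
    · simp only [List.length_cons, Expr.cost, Nat.succ_mul]; omega
  · exact ⟨by simpa using hc, by simp, fun r h5 _ _ _ => by simp [h5], fun v hv => hv,
      fun q hq => Or.inl (h9 q hq), fun v hv => Or.inl hv⟩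
  · rintro τ ⟨⟨L', T⟩, ⟨hc', hmem, hreg, -, hsound, hcov⟩, h0⟩
    cases L' with
    | nil => exact ⟨T, hmem, hreg, hsound, fun v hv => (hcov v hv).resolve_left (by simp)⟩
    | cons v L' =>
      have := hc'.1
      simp only [Expr.val] at h0
      omega

end EdgeData

end EdgeData

namespace EdgeData

variable {E : EdgeData} {S W s N v l : ℕ} {σ : State}

/-! ### Grouping the nodes by their slopes -/

/-- The nodes `u < v` with `Δ(u) = s`, in decreasing order. -/
def bucket (E : EdgeData) (v s : ℕ) : List ℕ :=
  ((List.range v).filter fun u => E.del u = s).reverse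

theorem mem_bucket {u : ℕ} : u ∈ E.bucket v s ↔ u < v ∧ E.del u = s := by
  simp [bucket]

theorem bucket_succ : E.bucket (v + 1) s =
    if E.del v = s then v :: E.bucket v s else E.bucket v s := by
  unfold bucket
  rw [List.range_succ, List.filter_append]
  split_ifs with h <;> simp [h]

theorem sum_length_bucket_le (I : Finset ℕ) : ∑ s ∈ I, (E.bucket v s).length ≤ v := by
  induction v with
  | zero => simp [bucket]
  | succ v ih =>
    calc ∑ s ∈ I, (E.bucket (v + 1) s).length
        = ∑ s ∈ I, ((E.bucket v s).length + if E.del v = s then 1 else 0) := by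
          refine Finset.sum_congr rfl fun s _ => ?_
          rw [bucket_succ]
          split_ifs <;> simp
      _ ≤ v + 1 := by
          rw [Finset.sum_add_distrib, Finset.sum_ite_eq]
          refine Nat.add_le_add ih ?_
          split_ifs <;> omega

theorem ends_buildLists (hS : 2 * E.n + 2 ≤ S) (hm : E.m ≤ S)
    (hW : E.bound + 4 * E.n + 2 * E.m + 20 < W) (hσ : E.Loaded σ) (h2 : σ.reg 2 = 0)
    (h7 : σ.mem 7 = fun _ => 0) :
    Ends S W buildLists σ (19 * E.m + 4) fun τ => E.Loaded τ ∧ τ.mem 10 = σ.mem 10 ∧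
      ∀ s, Chain (τ.mem 8) (τ.mem 7 s) (E.bucket E.m s) := by
  refine (Ends.upTo (a := 0) (b := E.m) (fun v τ => v ≤ E.m ∧ τ.reg 2 = v ∧ E.Loaded τ ∧
    τ.mem 10 = σ.mem 10 ∧ ∀ s, Chain (τ.mem 8) (τ.mem 7 s) (E.bucket v s)) (fun _ => 11) (by omega)
    ?_ ?_ ⟨by omega, h2, hσ, rfl, ?_⟩).mono ?_ ?_
  · rintro v τ ⟨hv, e2, hτ, -⟩
    have := hτ.2.1
    simp only [Expr.Fits, Expr.val]
    omega
  · rintro v τ ⟨-, e2, ⟨e0, e1, m0, m1, m3, m4⟩, h10, hc⟩ hv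
    have hd := E.del_le v hv
    have hh := (hc (E.del v)).le fun u hu => (mem_bucket.1 hu).1
    refine Ends.put_seq ?_ ?_ ?_ (by decide) ?_
    · simp only [Expr.Fits]; omega
    · simp only [Expr.Fits, Expr.val, e2, m4]; omega
    · simp only [Expr.val, e2]; omega
    simp only [Expr.val, e2, m4]
    refine Ends.put ?_ ?_ ?_ (by decide) ?_
    · simp [Expr.Fits, Expr.val, e2, m4]; omega
    · simp [Expr.Fits, Expr.val, Op.apply, e2]; omega
    · simp [Expr.val, e2, m4]; omega
    refine ⟨by simp [e2], by omega, by simp, ?_, by simp [h10], fun s => ?_⟩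
    · refine ⟨?_, ?_, ?_, ?_, ?_, ?_⟩ <;> simp [*]
    · have hL : ∀ u ∈ E.bucket v s, u < v := fun u hu => (mem_bucket.1 hu).1
      simp only [State.setReg_mem, State.setMem_mem, State.setMem_reg, Expr.val, Op.apply, e2, m4,
        bucket_succ]
      norm_num
      by_cases h : E.del v = s
      · rw [if_pos h, h, Function.update_self]
        refine ⟨rfl, ?_⟩
        rw [Function.update_self]
        exact (hc s).update hL
      · rw [if_neg h, Function.update_of_ne (Ne.symm h)]
        exact (hc s).update hL
  · intro s
    simp [bucket, Chain, h7]
  · simp [Expr.cost]; omega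
  · rintro τ ⟨-, -, hτ, h10, hc⟩
    exact ⟨hτ, h10, hc⟩

/-! ### The maximum for each length -/

/-- Every nonzero maximum is attained. -/
def MaxSound (E : EdgeData) (M : ℕ → ℕ) : Prop :=
  ∀ l, 0 < l → M l = 0 ∨ ∃ v, E.Edge v l ∧ M l = E.code v l

/-- The maxima take all edges of slopes less than `s` into account. -/
def MaxCovers (E : EdgeData) (s : ℕ) (M : ℕ → ℕ) : Prop :=
  ∀ v l, E.Edge v l → E.del v < s → E.code v l ≤ M l

/-- Subtracting the same amount from both weights preserves the lexicographic order of weight and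
node; `hx` excludes truncation. -/
theorem sub_mul_add_mod_mono {a b m x : ℕ} (hab : a ≤ b) (hx : x ≤ a / m) :
    (a / m - x) * m + a % m ≤ (b / m - x) * m + b % m := by
  have ha := Nat.div_add_mod' a m
  have hb := Nat.div_add_mod' b m
  have h1 : x * m ≤ a / m * m := Nat.mul_le_mul_right m hx
  have h2 : x * m ≤ b / m * m := Nat.mul_le_mul_right m (hx.trans (Nat.div_le_div_right hab))
  rw [Nat.sub_mul, Nat.sub_mul]
  omega

/-- The cover index at l is nonnegative, so decoding the key does not truncate. -/
theorem le_key_div (h : E.Edge v l) : E.del v * (E.n - l) ≤ E.key v / E.m := by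
  obtain ⟨hv, h1, h2⟩ := h
  have h3 := E.dep_le v hv
  have h4 : E.del v * (E.n - l) = E.del v * (E.dep v - l) + E.del v * (E.n - E.dep v) := by
    rw [← mul_add]; congr 1; omega
  rw [key_div hv, h4]
  exact Nat.add_le_add_right (E.le_cov v hv l h1 h2) _

/-- Slope s costs 26 + 140 = 166 steps per leaf, which add up to a harmonic sum, and O(log n) per
edge; each node lies in only one bucket. -/
theorem ends_computeMaxima (hS : 2 * E.n + 2 ≤ S) (hm : E.m ≤ S)
    (hW : E.bound + 4 * E.n + 2 * E.m + 20 < W) (hσ : E.Loaded σ) (h2 : σ.reg 2 = 1)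
    (hc : ∀ s, Chain (σ.mem 8) (σ.mem 7 s) (E.bucket E.m s)) (h10 : σ.mem 10 = fun _ => 0) :
    Ends S W computeMaxima σ
      (166 * (E.n * (Nat.log 2 E.n + 1)) + 197 * E.n + E.m * (38 * Nat.log 2 E.n + 118) + 6)
      fun τ => E.Loaded τ ∧ (∀ l, τ.mem 10 l ≤ E.bound) ∧ E.MaxSound (τ.mem 10) ∧
        E.MaxCovers (E.n + 1) (τ.mem 10) := by
  have hB := E.le_bound
  refine (Ends.upTo (a := 1) (b := E.n + 1) (fun s τ => s ≤ E.n + 1 ∧ 0 < s ∧ τ.reg 2 = s ∧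
    E.Loaded τ ∧ τ.mem 7 = σ.mem 7 ∧ τ.mem 8 = σ.mem 8 ∧ (∀ l, τ.mem 10 l ≤ E.bound) ∧
    E.MaxSound (τ.mem 10) ∧ E.MaxCovers s (τ.mem 10))
    (fun s => 166 * (E.n / s + 1) + 21 + (E.bucket E.m s).length * (38 * Nat.log 2 E.n + 118))
    (by omega) ?_ ?_ ⟨by omega, one_pos, h2, hσ, rfl, rfl, by simp [h10],
      fun l _ => Or.inl (by simp [h10]), ?_⟩).mono ?_ ?_
  · rintro s τ ⟨hs, -, e2, ⟨e0, -⟩, -⟩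
    refine ⟨hs, e2, by simp only [Expr.val, Op.apply, e0], ?_⟩
    simp only [Expr.Fits, Expr.val, Op.apply, e0]
    omega
  · rintro s τ ⟨-, hs0, e2, ⟨e0, e1, m0, m1, m3, m4⟩, m7, m8, hMB, hMs, hMc⟩ hs
    have hsn : s ≤ E.n := Nat.lt_succ_iff.1 hs
    obtain ⟨N, hN⟩ : ∃ N, N = E.n / s + 1 := ⟨_, rfl⟩
    have hNn : N ≤ E.n + 1 := by
      rw [hN]
      exact Nat.add_le_add_right (Nat.div_le_self _ _) 1
    rw [← hN]
    refine Ends.seq (T₁ := 6) (T₂ := 2 + (26 * N + 6 +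
      ((E.bucket E.m s).length * (38 * Nat.log 2 E.n + 118) + 5 + (2 + 140 * N))))
      (Ends.set (by simp only [Expr.Fits, Expr.val, Op.apply, e0, e2]; omega) (by decide) ?_)
      (by omega)
    refine Ends.seq (T₁ := 2) (Ends.set (by simp only [Expr.Fits]; omega) (by decide) ?_) le_rfl
    refine Ends.seq ((ends_clearTree (N := N) (by omega) (by omega)
      (by simp [Expr.val, Op.apply, e0, e2, hN]) (by simp [Expr.val])).mono le_rfl ?_) le_rfl
    rintro τ1 ⟨T, hmem1, hreg1, hT⟩
    simp only [State.setReg_mem, State.setReg_reg] at hmem1 hreg1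
    have hτ1 : E.Loaded τ1 := by
      refine ⟨?_, ?_, ?_, ?_, ?_, ?_⟩ <;> simp [*]
    refine Ends.seq ((ends_insertEdges (hd := σ.mem 7) (nx := σ.mem 8) hS hm hW hτ1
      (by simp [hreg1, e2]) (N := N) (by simp [hreg1, hN, Expr.val, Op.apply, e0, e2])
      (by simp [hmem1, m7]) (by simp [hmem1, m8]) hs0 hsn hN (fun v hv => mem_bucket.1 hv) (hc s)
      (by simpa [hmem1] using hT)).mono le_rfl ?_) le_rfl
    rintro τ2 ⟨T2, hmem2, hreg2, hsound, hcov⟩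
    refine Ends.seq (T₁ := 2) (Ends.set (by simp only [Expr.Fits]; omega) (by decide) ?_) le_rfl
    have hTB : ∀ q < 2 * N, T2 q ≤ E.bound := by
      intro q hq
      rcases hsound q hq with h | ⟨v', hv', h, -⟩
      · omega
      · rw [h]
        exact (key_lt (mem_bucket.1 hv').1 ((mem_bucket.1 hv').2.trans_le hsn)).le
    have hsn2 : s * E.n ≤ E.n * E.n := Nat.mul_le_mul_right _ hsn
    refine (ends_pushDown (N := N) (B := E.bound) (s := s) (n := E.n) (m := E.m) (T₀ := T2)
      (M₀ := τ.mem 10) (by omega) (by omega) (by omega) (hN ▸ Nat.succ_pos _) hNn (by omega)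
      (by simp [hreg2, hreg1, e0]) (by simp [hreg2, hreg1, e1]) (by simp [hreg2, hreg1, e2])
      (by simp [hreg2, hreg1, Expr.val, Op.apply, e0, e2, hN]) (by simp [Expr.val]) (by omega)
      (by omega) (by omega) (by simp [hmem2]) (by simp [hmem2, hmem1]) hTB hMB).mono le_rfl ?_
    rintro τ3 ⟨T3, M, hmem3, hreg3, hMB', hT3, hM⟩
    simp only [State.setReg_mem, State.setReg_reg] at hmem3 hreg3
    have hm10 : τ3.mem 10 = M := by simp [hmem3]
    refine ⟨by simp [hreg3, hreg2, hreg1, e2], by omega, by omega, by simp, ?_, ?_, ?_, ?_, ?_, ?_⟩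
    · refine ⟨?_, ?_, ?_, ?_, ?_, ?_⟩ <;> simp [*]
    · simp [hmem3, hmem2, hmem1, m7]
    · simp [hmem3, hmem2, hmem1, m8]
    · simpa [hm10] using hMB'
    · rw [State.setReg_mem, hm10]
      intro l hl
      rw [hM l hl]
      split_ifs with hlN
      · rcases le_total ((T3 (N + l) / E.m - s * (E.n - l)) * E.m + T3 (N + l) % E.m) (τ.mem 10 l)
          with h | h
        · rw [max_eq_left h]
          exact hMs l hl
        · rw [max_eq_right h]
          obtain ⟨k, hk⟩ := (hT3 (N + l) hlN).2
          rcases hsound ((N + l) / 2 ^ k) (lt_of_le_of_lt (Nat.div_le_self _ _) hlN) with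
            h0 | ⟨v, hv, hkey, hin⟩
          · left
            rw [hk, h0]; simp
          · right
            obtain ⟨hvm, hvs⟩ := mem_bucket.1 hv
            have hp := hin (N + l) k (by omega) hlN rfl
            have he : E.Edge v l := ⟨hvm, by omega, by omega⟩
            refine ⟨v, he, ?_⟩
            rw [hk, hkey, ← hvs]
            exact key_to_code he
      · exact hMs l hl
    · rw [State.setReg_mem, hm10]
      intro v l he hvs
      have hl : 0 < l := by have := he.2.1; omega
      rw [hM l hl]
      rcases Nat.lt_succ_iff_lt_or_eq.1 hvs with h | h
      · split_ifs
        · exact (hMc v l he h).trans (le_max_left _ _)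
        · exact hMc v l he h
      · have hdepN : E.dep v + 1 ≤ N := by
          rw [hN, Nat.add_le_add_iff_right, Nat.le_div_iff_mul_le hs0, mul_comm, ← h]
          exact E.del_mul_dep_le v he.1
        have hlN : N + l < 2 * N := by have := he.2.2; omega
        rw [if_pos hlN]
        refine le_trans ?_ (le_max_right _ _)
        -- Some node above the leaf holds at least the key of `v`; pushing down brings it to the
        -- leaf, and decoding is monotone.
        obtain ⟨k, hk⟩ := hcov v (mem_bucket.2 ⟨he.1, h⟩) (N + l) (by have := he.2.1; omega)
          (by have := he.2.2; omega)
        rw [← key_to_code he, h]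
        exact sub_mul_add_mod_mono (hk.trans ((hT3 _ hlN).1 k)) (h ▸ le_key_div he)
  · intro v l he hv
    have := E.del_pos v he.1
    omega
  · have h1 := sum_div_le E.n
    have h2 := E.sum_length_bucket_le (v := E.m) (Finset.Ico 1 (E.n + 1))
    have h3 := Nat.mul_le_mul_right (38 * Nat.log 2 E.n + 118) h2
    simp only [Finset.sum_add_distrib, ← Finset.mul_sum, ← Finset.sum_mul, Finset.sum_const,
      Nat.card_Ico, Expr.cost, smul_eq_mul]
    omega
  · rintro τ ⟨-, -, -, hτ, -, -, h⟩
    exact ⟨hτ, h⟩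

/-! ### Reading off the output -/

/-- Cell `α` of the arrays `5` and `6` holds a shortest edge position of weight at least `α`. -/
def Output (E : EdgeData) (σ : State) (α : ℕ) : Prop :=
  ∃ v l, E.Edge v l ∧ σ.mem 5 α = v ∧ σ.mem 6 α = E.dep v - l ∧ α ≤ E.covAt v l ∧
    ∀ v' l', E.Edge v' l' → α ≤ E.covAt v' l' → l ≤ l'

theorem Output.congr {τ : State} {α : ℕ} (h : E.Output σ α) (h5 : τ.mem 5 α = σ.mem 5 α)
    (h6 : τ.mem 6 α = σ.mem 6 α) : E.Output τ α := by
  rw [Output, h5, h6]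
  exact h

theorem covAt_le (h : E.Edge v l) : E.covAt v l ≤ E.n := (Nat.sub_le _ _).trans (E.cov_le v h.1)

/-- The body of the outer loop of `writeOutput`. -/
theorem ends_writeCells {M : ℕ → ℕ} {a : ℕ} (hS : 2 * E.n + 2 ≤ S) (hm : E.m ≤ S)
    (hW : E.bound + 4 * E.n + 2 * E.m + 20 < W) (hσ : E.Loaded σ) (h2 : σ.reg 2 = l)
    (h3 : σ.reg 3 = a) (h10 : σ.mem 10 = M) (hl : 0 < l) (hln : l ≤ E.n) (ha : a ≤ E.n + 1)
    (ha0 : 0 < a) (hMB : M l ≤ E.bound) (hMs : E.MaxSound M)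
    (hout : ∀ α, 0 < α → α < a → E.Output σ α)
    (hlow : ∀ v' l', E.Edge v' l' → l' < l → E.covAt v' l' < a) :
    Ends S W (.while (.bin .lt (.reg 3) (.bin .add (.bin .div (.get 10 (.reg 2)) (.reg 1)) (.lit 1)))
      (.seq (.put 5 (.reg 3) (.bin .mod (.get 10 (.reg 2)) (.reg 1)))
      (.seq (.put 6 (.reg 3)
        (.bin .sub (.get 1 (.bin .mod (.get 10 (.reg 2)) (.reg 1))) (.reg 2)))
        (.set 3 (.bin .add (.reg 3) (.lit 1)))))) σ (28 * (max a (M l / E.m + 1) - a) + 9) fun τ =>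
      E.Loaded τ ∧ τ.reg 2 = l ∧ τ.reg 3 = max a (M l / E.m + 1) ∧ τ.mem 10 = M ∧
        ∀ α, 0 < α → α < max a (M l / E.m + 1) → E.Output τ α := by
  have hdiv : M l / E.m ≤ M l := Nat.div_le_self _ _
  refine (Ends.while (γ := ℕ) (fun b τ => E.Loaded τ ∧ τ.reg 2 = l ∧ τ.reg 3 = b ∧ a ≤ b ∧
    b ≤ max a (M l / E.m + 1) ∧ τ.mem 10 = M ∧ ∀ α, 0 < α → α < b → E.Output τ α)
    (fun b => 28 * (max a (M l / E.m + 1) - b) + 9) ?_ ?_ ?_ (g := a)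
    ⟨hσ, h2, h3, le_rfl, le_max_left _ _, h10, hout⟩).mono le_rfl ?_
  · rintro b τ ⟨⟨e0, e1, -⟩, e2, e3, hab, hb, m10, -⟩
    simp only [Expr.Fits, Expr.val, Op.apply, e1, e2, e3, m10]
    split_ifs <;> omega
  · rintro b τ -
    simp [Expr.cost]
  · rintro b τ ⟨⟨e0, e1, m0, m1, m3, m4⟩, e2, e3, hab, -, m10, hout⟩ h0
    have hlt : b < M l / E.m + 1 := by
      by_contra hc
      simp [Expr.val, Op.apply, e1, e2, e3, m10, hc] at h0
    -- A zero maximum would give b < 1, against 0 < a ≤ b.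
    rcases hMs l hl with hz | ⟨v, he, hv⟩
    · rw [hz] at hlt
      simp at hlt; omega
    have hdep := E.dep_le v he.1
    have hmod : M l % E.m = v := by rw [hv, code_mod he.1]
    have hcv : M l / E.m = E.covAt v l := by rw [hv, code_div he.1]
    have hcn := covAt_le he
    have hvm := he.1
    refine ⟨19, Ends.put_seq ?_ ?_ ?_ (by decide) ?_⟩
    · simp only [Expr.Fits]; omega
    · simp only [Expr.Fits, Expr.val, Op.apply, e1, e2, m10, hmod]; omega
    · simp only [Expr.val]; omega
    simp only [Expr.val, Op.apply, e1, e2, e3, m10, hmod]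
    refine Ends.put_seq ?_ ?_ ?_ (by decide) ?_
    · simp only [Expr.Fits, State.setMem_reg]; omega
    · simp [Expr.Fits, Expr.val, Op.apply, e1, e2, m10, m1, hmod]; omega
    · simp [Expr.val, e3]; omega
    have hx : (Expr.bin .sub (.get 1 (.bin .mod (.get 10 (.reg 2)) (.reg 1))) (.reg 2)).val
        (τ.setMem 5 b v) = E.dep v - l := by
      simp [Expr.val, Op.apply, e1, e2, m10, m1, hmod]
    have hi : (Expr.reg 3).val (τ.setMem 5 b v) = b := e3
    rw [hx, hi]
    refine Ends.set ?_ (by decide) ⟨b + 1, ⟨?_, ?_, ?_, ?_, ?_, ?_, ?_⟩, ?_⟩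
    · simp only [Expr.Fits, Expr.val, Op.apply, State.setMem_reg]; omega
    · refine ⟨?_, ?_, ?_, ?_, ?_, ?_⟩ <;> simp [*]
    · simp [e2]
    · simp [Expr.val, Op.apply, e3]
    · omega
    · omega
    · simp [m10]
    · intro α h1 h2
      by_cases hα : α = b
      · subst hα
        refine ⟨v, l, he, by simp, by simp, by omega, fun v' l' he' hle => ?_⟩
        by_contra hc
        have := hlow v' l' he' (by omega)
        omega
      · exact (hout α h1 (by omega)).congr (by simp [hα]) (by simp [hα])
    · simp only [Expr.cost]; omega
  · rintro τ ⟨b, ⟨hτ, e2, e3, hab, hb, m10, hout⟩, h0⟩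
    have hlt : ¬ b < M l / E.m + 1 := by
      intro hc
      simp [Expr.val, Op.apply, hτ.2.1, e2, e3, m10, hc] at h0
    have : b = max a (M l / E.m + 1) := by omega
    subst this
    exact ⟨hτ, e2, e3, m10, hout⟩

/-- The potential counts the remaining lengths and the unanswered α together, so the inner loops are
amortised. The invariant says that no edge position shorter than l reaches the next α. -/
theorem ends_writeOutput (hS : 2 * E.n + 2 ≤ S) (hm : E.m ≤ S)
    (hW : E.bound + 4 * E.n + 2 * E.m + 20 < W) (hσ : E.Loaded σ) (h2 : σ.reg 2 = 1)
    (h3 : σ.reg 3 = 1) (hMB : ∀ l, σ.mem 10 l ≤ E.bound) (hMs : E.MaxSound (σ.mem 10))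
    (hMc : E.MaxCovers (E.n + 1) (σ.mem 10)) :
    Ends S W writeOutput σ (47 * E.n + 6) fun τ => ∀ α, 0 < α → α ≤ E.n → E.Output τ α := by
  refine (Ends.while (γ := ℕ × ℕ) (fun g τ => E.Loaded τ ∧ τ.reg 2 = g.1 ∧ τ.reg 3 = g.2 ∧
    0 < g.1 ∧ g.1 ≤ E.n + 1 ∧ 0 < g.2 ∧ g.2 ≤ E.n + 1 ∧ τ.mem 10 = σ.mem 10 ∧
    (∀ α, 0 < α → α < g.2 → E.Output τ α) ∧
    ∀ v l, E.Edge v l → l < g.1 → E.covAt v l < g.2)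
    (fun g => 19 * (E.n + 1 - g.1) + 28 * (E.n + 1 - g.2) + 6) ?_ ?_ ?_ (g := (1, 1)) ?_).mono
    (by simp only; omega) ?_
  · rintro ⟨l, a⟩ τ ⟨⟨e0, -⟩, e2, -, -, hl, -⟩
    simp only at hl e2
    simp only [Expr.Fits, Expr.val, Op.apply, e0, e2]
    split_ifs <;> omega
  · rintro ⟨l, a⟩ τ -
    simp [Expr.cost]
  · rintro ⟨l, a⟩ τ ⟨hτ, e2, e3, hl0, hl, ha0, ha, m10, hout, hlow⟩ h0
    simp only at e2 e3 hl0 hl ha0 ha hout hlow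
    have hln : l < E.n + 1 := by
      by_contra hc
      simp [Expr.val, Op.apply, hτ.1, e2, hc] at h0
    have hMn : σ.mem 10 l / E.m ≤ E.n := by
      rcases hMs l hl0 with h | ⟨v, he, hv⟩
      · simp [h]
      · rw [hv, code_div he.1]
        exact covAt_le he
    refine ⟨28 * (max a (σ.mem 10 l / E.m + 1) - a) + 9 + 4, Ends.seq ((ends_writeCells hS hm hW hτ
      e2 e3 m10 hl0 (by omega) ha ha0 (hMB l) hMs hout hlow).mono le_rfl ?_) le_rfl⟩
    rintro τ1 ⟨hτ1, e2', e3', m10', hout'⟩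
    refine Ends.set ?_ (by decide) ⟨(l + 1, max a (σ.mem 10 l / E.m + 1)),
      ⟨?_, ?_, ?_, ?_, ?_, ?_, ?_, ?_, ?_, ?_⟩, ?_⟩
    · simp only [Expr.Fits, Expr.val, Op.apply]; omega
    · obtain ⟨e0, e1, m0, m1, m3, m4⟩ := hτ1
      refine ⟨?_, ?_, ?_, ?_, ?_, ?_⟩ <;> simp [*]
    · simp [Expr.val, Op.apply, e2']
    · simp [e3']
    · simp
    · simp only; omega
    · simp only; omega
    · simp only; omega
    · exact m10'
    · exact hout'
    · intro v l' he hl'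
      simp only at hl' ⊢
      rcases Nat.lt_succ_iff_lt_or_eq.1 hl' with h | rfl
      · exact (hlow v l' he h).trans_le (le_max_left _ _)
      · have h1 : E.del v < E.n + 1 := by
          have h2 := E.del_mul_dep_le v he.1
          have h3 : 0 < E.dep v := by have := he.2.1; have := he.2.2; omega
          have := Nat.le_mul_of_pos_right (E.del v) h3
          omega
        have := Nat.div_le_div_right (c := E.m) (hMc v l' he h1)
        rw [code_div he.1] at this
        omega
    · simp only [Expr.cost]; omega
  · exact ⟨hσ, h2, h3, one_pos, by simp, one_pos, by simp, rfl, fun α h1 h2 => by omega,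
      fun v l he hl => by have := he.2.1; omega⟩
  · rintro τ ⟨⟨l, a⟩, ⟨hτ, e2, -, -, hl, -, -, -, hout, hlow⟩, h0⟩ α h1 h2
    simp only at e2 hl hout hlow
    have hln : ¬ l < E.n + 1 := by
      intro hc
      simp [Expr.val, Op.apply, hτ.1, e2, hc] at h0
    -- The whole word has cover index n at length n, so the scan ends with every α ≤ n answered.
    obtain ⟨v, hv, hpar, hdep, hcov⟩ := E.exists_full (by omega)
    have := hlow v E.n ⟨hv, hpar, hdep.ge⟩ (by omega)
    rw [covAt, hdep, hcov] at this
    simp only [Nat.sub_self, mul_zero, Nat.sub_zero] at this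
    exact hout α h1 (by omega)

/-! ### The whole program on abstract edge data -/

theorem ends_partialCovers (hS : 2 * E.n + 2 ≤ S) (hm : E.m ≤ S)
    (hW : E.bound + 4 * E.n + 2 * E.m + 20 < W) (hσ : E.Loaded σ) (h2 : σ.reg 2 = 0)
    (h7 : σ.mem 7 = fun _ => 0) (h10 : σ.mem 10 = fun _ => 0) :
    Ends S W partialCovers σ (166 * (E.n * (Nat.log 2 E.n + 1)) + 244 * E.n +
      E.m * (38 * Nat.log 2 E.n + 137) + 22) fun τ => ∀ α, 0 < α → α ≤ E.n → E.Output τ α := by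
  have set_loaded : ∀ {τ : State} (r x : ℕ), 2 ≤ r → E.Loaded τ → E.Loaded (τ.setReg r x) := by
    rintro τ r x hr ⟨e0, e1, m0, m1, m3, m4⟩
    refine ⟨?_, ?_, ?_, ?_, ?_, ?_⟩ <;> simp [*] <;> omega
  have hT : E.m * (38 * Nat.log 2 E.n + 137) = E.m * (38 * Nat.log 2 E.n + 118) + 19 * E.m := by
    ring
  refine Ends.seq ((ends_buildLists hS hm hW hσ h2 h7).mono le_rfl ?_)
    (T₂ := 166 * (E.n * (Nat.log 2 E.n + 1)) + 244 * E.n +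
      E.m * (38 * Nat.log 2 E.n + 118) + 18) (by omega)
  rintro τ ⟨hτ, m10, hc⟩
  refine Ends.seq (T₁ := 2) (Ends.set (by simp only [Expr.Fits]; omega) (by decide) (Ends.seq
    ((ends_computeMaxima hS hm hW (set_loaded _ _ le_rfl hτ) (by simp [Expr.val]) hc
      (by simp [m10, h10])).mono le_rfl ?_) (T₂ := 2 + (2 + (47 * E.n + 6))) le_rfl)) (by omega)
  rintro τ ⟨hτ, hMB, hMs, hMc⟩
  exact Ends.seq (Ends.set (by simp only [Expr.Fits]; omega) (by decide) (Ends.seq (Ends.set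
    (by simp only [Expr.Fits]; omega) (by decide) (ends_writeOutput hS hm hW
      (set_loaded _ _ (by norm_num) (set_loaded _ _ le_rfl hτ)) (by simp [Expr.val])
      (by simp [Expr.val]) hMB hMs hMc)) le_rfl)) le_rfl

end EdgeData

/-! ### The Cover Suffix Tree as input -/

section Main

variable {A : Type*} {w : List A}

theorem nodeArray_of_lt {m : ℕ} (f : Fin m → ℕ) {v : ℕ} (hv : v < m) :
    nodeArray f v = f ⟨v, hv⟩ := dif_pos hv

/-- The numerical data of a Cover Suffix Tree. -/
noncomputable def CST.edgeData (T : CST w) : EdgeData where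
  n := w.length
  m := T.size
  par := nodeArray fun v => (T.parent v : ℕ)
  dep := nodeArray fun v => (T.word v).length
  cov := nodeArray fun v => covered (T.word v) w
  del := nodeArray fun v => delta (T.word v) w
  m_pos := by
    obtain ⟨v, -⟩ := (T.exists_word_eq_iff []).2 (Or.inl List.nil_suffix)
    exact v.pos
  par_lt v hv := by
    rw [nodeArray_of_lt _ hv]
    exact Fin.is_lt _
  dep_le v hv := by
    rw [nodeArray_of_lt _ hv]
    exact (T.word_infix _).length_le
  dep_par_le v hv := by
    rw [nodeArray_of_lt _ hv, nodeArray_of_lt _ hv, nodeArray_of_lt _ (Fin.is_lt _), Fin.eta]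
    by_cases h : T.word ⟨v, hv⟩ = []
    · rw [T.parent_root _ h]
    · exact (T.parent_prefix _ h).2.le
  cov_le v hv := by
    rw [nodeArray_of_lt _ hv]
    exact covered_le _ _
  del_le v hv := by
    rw [nodeArray_of_lt _ hv]
    exact delta_le _ _
  del_pos v hv := by
    rw [nodeArray_of_lt _ hv]
    exact delta_pos (T.word_infix _)
  del_mul_dep_le v hv := by
    rw [nodeArray_of_lt _ hv, nodeArray_of_lt _ hv]
    exact delta_mul_length_le _ _
  le_cov v hv l h1 h2 := by
    rw [nodeArray_of_lt _ hv, nodeArray_of_lt _ (Fin.is_lt _), Fin.eta] at h1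
    rw [nodeArray_of_lt _ hv] at h2
    rw [nodeArray_of_lt _ hv, nodeArray_of_lt _ hv, nodeArray_of_lt _ hv, ← T.covered_take h1 h2]
    exact Nat.le_add_left _ _
  exists_full hn := by
    obtain ⟨v, hv⟩ := (T.exists_word_eq_iff w).2 (Or.inl List.suffix_rfl)
    have hne : T.word v ≠ [] := by
      rw [hv]
      exact List.ne_nil_of_length_pos hn
    have hlt := (T.parent_prefix v hne).2
    refine ⟨v, v.2, ?_, ?_, ?_⟩
    · rw [nodeArray_of_lt _ v.2, nodeArray_of_lt _ (Fin.is_lt _), Fin.eta, Fin.eta]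
      exact hlt.trans_eq (congrArg List.length hv)
    · rw [nodeArray_of_lt _ v.2, Fin.eta, hv]
    · rw [nodeArray_of_lt _ v.2, Fin.eta, hv, covered_self]

theorem CST.edge_iff {T : CST w} {v : Fin T.size} {l : ℕ} :
    T.edgeData.Edge v l ↔ (T.word (T.parent v)).length < l ∧ l ≤ (T.word v).length := by
  simp only [EdgeData.Edge, CST.edgeData]
  rw [nodeArray_of_lt _ v.2, nodeArray_of_lt _ (Fin.is_lt _), nodeArray_of_lt _ v.2]
  simp

theorem CST.covAt_eq {T : CST w} {v : Fin T.size} {l : ℕ} (h : T.edgeData.Edge v l) :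
    T.edgeData.covAt v l = covered ((T.word v).take l) w := by
  rw [T.edge_iff] at h
  simp only [EdgeData.covAt, CST.edgeData]
  rw [nodeArray_of_lt _ v.2, nodeArray_of_lt _ v.2, nodeArray_of_lt _ v.2, Fin.eta,
    ← T.covered_take h.1 h.2, Nat.add_sub_cancel]

theorem CST.outputAt {T : CST w} {σ : State} {α : ℕ} (hα : 0 < α)
    (h : T.edgeData.Output σ α) : T.OutputAt σ α := by
  obtain ⟨v, l, he, h5, h6, hcov, hmin⟩ := h
  obtain ⟨v, rfl⟩ : ∃ v' : Fin T.size, (v' : ℕ) = v := ⟨⟨v, he.1⟩, rfl⟩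
  have hdep : T.edgeData.dep v = (T.word v).length :=
    nodeArray_of_lt (fun v => (T.word v).length) v.2
  rw [T.covAt_eq he] at hcov
  have he' := T.edge_iff.1 he
  refine ⟨v, (T.word v).take l, h5, ⟨?_, ?_⟩,
    ⟨(List.take_prefix _ _).isInfix.trans (T.word_infix v), hcov⟩, fun u' hu' hc => ?_⟩
  · rw [h6, hdep]
    right; omega
  · rw [h6, hdep]
    congr 1; omega
  -- The empty word lies on no edge, but it covers nothing while α ≥ 1.
  · have hne : u' ≠ [] := by
      rintro rfl
      rw [covered_nil] at hc
      omega
    obtain ⟨v', h1, h2, h3⟩ := T.exists_edge hu' hne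
    have hv' : T.edgeData.Edge v' u'.length := T.edge_iff.2 ⟨h1, h2⟩
    have := hmin v' u'.length hv' (by rwa [T.covAt_eq hv', ← h3])
    simp only [List.length_take]
    omega

/-- The keys are O(n³); since n + 2 ≥ 2, the exponent 8 leaves a factor 2 ^ 5 that absorbs the
constants even for n = 0. -/
theorem size_lt_word_bound {n m : ℕ} (hm : m ≤ 4 * (n + 1)) :
    (n * n + n + 1) * m + 4 * n + 2 * m + 20 < (n + 2) ^ 8 := by
  obtain ⟨x, rfl⟩ : ∃ x, x = n + 2 := ⟨_, rfl⟩
  have h1 : (n * n + n + 1) * m ≤ 4 * (n + 2) ^ 3 := by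
    calc (n * n + n + 1) * m ≤ (n * n + n + 1) * (4 * (n + 1)) := Nat.mul_le_mul_left _ hm
      _ ≤ 4 * (n + 2) ^ 3 := by nlinarith
  have h2 : 2 ^ 5 * (n + 2) ^ 3 ≤ (n + 2) ^ 8 := by
    calc 2 ^ 5 * (n + 2) ^ 3 ≤ (n + 2) ^ 5 * (n + 2) ^ 3 :=
          Nat.mul_le_mul_right _ (Nat.pow_le_pow_left (Nat.le_add_left 2 n) 5)
      _ = (n + 2) ^ 8 := by rw [← pow_add]
  have h3 : 4 * (n + 2) ≤ (n + 2) ^ 3 := by nlinarith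
  omega

/-- By n ≤ n log n + 1 and log n ≤ n log n, the coefficient of n log n is 318 + 958 + 152 = 1428 and
the constant term 958 + 570 = 1528. -/
theorem time_le {n m : ℕ} (hm : m ≤ 4 * (n + 1)) :
    166 * (n * (Nat.log 2 n + 1)) + 244 * n + m * (38 * Nat.log 2 n + 137) + 22 ≤
      1528 * (n * Nat.log 2 n + 1) := by
  have h1 : n ≤ n * Nat.log 2 n + 1 := by
    rcases lt_or_ge n 2 with h | h
    · omega
    · have := Nat.le_mul_of_pos_right n (Nat.log_pos one_lt_two h)
      omega
  have h2 : Nat.log 2 n ≤ n * Nat.log 2 n := by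
    rcases Nat.eq_zero_or_pos n with rfl | h
    · simp
    · exact Nat.le_mul_of_pos_left _ h
  have h3 := Nat.mul_le_mul_right (38 * Nat.log 2 n + 137) hm
  have h4 : 4 * (n + 1) * (38 * Nat.log 2 n + 137) =
      152 * (n * Nat.log 2 n) + 548 * n + 152 * Nat.log 2 n + 548 := by ring
  rw [mul_add n]
  omega

theorem CST.ends_partialCovers (T : CST w) :
    Ends (1528 * (w.length + 1)) ((w.length + 2) ^ 8) partialCovers T.input
      (1528 * (w.length * Nat.log 2 w.length + 1))
      fun σ => ∀ α, 1 ≤ α → α ≤ w.length → T.OutputAt σ α := by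
  have hm := T.size_le
  refine (EdgeData.ends_partialCovers (E := T.edgeData) ?_ ?_ (size_lt_word_bound hm)
    ⟨rfl, rfl, rfl, rfl, rfl, rfl⟩ rfl rfl rfl).mono (time_le hm)
    fun σ h α h1 h2 => T.outputAt h1 (h α h1 h2)
  · change 2 * w.length + 2 ≤ _
    omega
  · change T.size ≤ _
    omega

end Main

end PartialCovers

theorem mainTheorem5 :
    ∃ (P : PartialCovers.Prog) (C k : ℕ), ∀ (A : Type*) (w : List A) (T : PartialCovers.CST w),
      T.size ≤ C * (w.length + 1) ∧
      ∃ (t : ℕ) (σ : PartialCovers.State),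
        PartialCovers.Exec (C * (w.length + 1)) ((w.length + 2) ^ k) P T.input t σ ∧
        t ≤ C * (w.length * Nat.log 2 w.length + 1) ∧
        ∀ α : ℕ, 1 ≤ α → α ≤ w.length → T.OutputAt σ α := by
  -- The constant 1528 comes from the time bound; for the nodes and the array cells 4 would do.
  refine ⟨PartialCovers.partialCovers, 1528, 8, fun A w T => ⟨?_, T.ends_partialCovers⟩⟩
  have := T.size_le
  omega
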